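/- Let ${\bf c}=(c_1,\dots,c_m)$ and ${\bf d}=(d_1,\dots,d_n)$ be sequences of positive integers with $3\le c_1\le\dots\le c_m$ and $3\le d_1\le\dots\le d_n$, and let $r$ and $s$ be integers with $1\le r\le m$ and $1\le s\le n$. Let $S_{\bf c}^{(r)}$ be the set of all integer sequences $(a_1,\dots,a_m)$ such that $0\le a_i\le c_i$ for each $i$ and exactly $r$ of the entries $a_i$ are non-zero, and let $S_{\bf c}^{(r)}(1)$ be the set of those members with $a_1=1$; define $S_{\bf d}^{(s)}$ and $S_{\bf d}^{(s)}(1)$ in the same way. Let $A\subseteq S_{\bf c}^{(r)}$ and $B\subseteq S_{\bf d}^{(s)}$ be such that for every $(a_1,\dots,a_m)\in A$ and every $(b_1,\dots,b_n)\in B$ there is some $i\le\min\{m,n\}$ with $a_i=b_i\neq 0$. Then \[|A||B|\le |S_{\bf c}^{(r)}(1)|\,|S_{\bf d}^{(s)}(1)| = \Bigg(\sum_{I\in\binom{\{2,\dots,m\}}{r-1}}\prod_{i\in I}c_i\Bigg)\Bigg(\sum_{J\in\binom{\{2,\dots,n\}}{s-1}}\prod_{j\in J}d_j\Bigg),\]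 where the first factor on the right is $|S_{\bf c}^{(r)}(1)|$ and the second is $|S_{\bf d}^{(s)}(1)|$. Moreover, $|A||B| = |S_{\bf c}^{(r)}(1)|\,|S_{\bf d}^{(s)}(1)|$ if and only if, for some $p\in\{1,\dots,\min\{m,n\}\}$ such that ($r=1$ or $c_p=c_1$) and ($s=1$ or $d_p=d_1$), and some integer $q$ with $1\le q\le\min\{c_p,d_p\}$, \[A=\{(a_1,\dots,a_m)\in S_{\bf c}^{(r)}\colon a_p=q\}\quad\text{and}\quad B=\{(b_1,\dots,b_n)\in S_{\bf d}^{(s)}\colon b_p=q\}.\] In particular, if $r,s\ge 2$, then $p$ ranges over the positions with $c_p=c_1$ and $d_p=d_1$. -/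

import Mathlib

/-- An increasing positive sequence (IP sequence) `1 ≤ c₁ ≤ ⋯ ≤ cₙ`. Sequences of length `n` are
functions on `Fin n`; the entry `c₁` is `c 0`. -/
def IsIPSeq {n : ℕ} (c : Fin n → ℕ) : Prop :=
  (∀ i, 0 < c i) ∧ Monotone c

/-- `S_c^{(r)}`: the sequences `(a₁, …, aₙ)` of non-negative integers with exactly `r` positive
entries and `0 ≤ aᵢ ≤ cᵢ` for every `i`. -/
def partialSeqs {n : ℕ} (c : Fin n → ℕ) (r : ℕ) : Finset (Fin n → ℕ) :=
  (Fintype.piFinset fun i => Finset.Icc 0 (c i)).filter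
    fun a => (Finset.univ.filter fun i => a i ≠ 0).card = r

/-- The members of `S_c^{(r)}` whose entry in position `p` is `q`.
In particular `S_c^{(r)}(1)` is `seqStar c r 0 1`. -/
def seqStar {n : ℕ} (c : Fin n → ℕ) (r : ℕ) (p : Fin n) (q : ℕ) : Finset (Fin n → ℕ) :=
  (partialSeqs c r).filter fun a => a p = q

/-- Two sequences, possibly of different lengths, meet if they have the same positive entry in
some common position. -/
def Meets {m n : ℕ} (a : Fin m → ℕ) (b : Fin n → ℕ) : Prop :=
  ∃ (i : Fin m) (j : Fin n), (i : ℕ) = (j : ℕ) ∧ a i = b j ∧ a i ≠ 0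

/-- The sum over all `(r - 1)`-element sets `I` of positions other than the first one of the
products of the `cᵢ` with `i ∈ I`. -/
def starSum {n : ℕ} [NeZero n] (c : Fin n → ℕ) (r : ℕ) : ℕ :=
  ∑ I ∈ Finset.powersetCard (r - 1) (Finset.univ.erase (0 : Fin n)), ∏ i ∈ I, c i

/-!
The proof compresses the two sets of sequences to families of finite sets with weights, and bounds
the weights by induction on the size of the ground set.

*From sequences to sets.* Changing an entry `k ≥ 2` in position `i` to `1`, in all members of `A`
and `B` for which the result is not already present (`compression` along `setOne i k`), keeps the
cardinalities and the property that every member of `A` meets every member of `B`. When no such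
step changes anything, members of `A` and `B` even meet in an entry `1`
(`ones_inter_ones_nonempty`). So the sets `ones a` and `ones b` of positions of ones form
cross-intersecting families, and `|A|` is at most the weight of its family if a set `T` is weighted
by the number `seqWeight c r T` of sequences with `ones a = T`. As `cᵢ ≥ 3`, a `1` can be changed
to `2` or `3`, so adding a position to `T` at least halves the weight; as `c` is increasing,
swapping entries shows that replacing a position by a smaller one does not lower it
(`admissible_seqWeight`).

*The weighted theorem* (`weightedBound`). For such weights, cross-intersecting families `F`, `G` of
subsets of `{0, …, n}` have a product of weights at most that of the stars at `0`. Take a pair with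
the largest product, without members of weight zero and stable under shifts. Then no `A ∈ F` and
`B ∈ G` meet in `n` only (`inter_ne_last`): such `A` and `B` would cover everything, and one could
exchange `A ∈ F` for `B.erase n ∈ G`, or `B` for `A.erase n` (`exchange`). Optimality gives two
inequalities between the weights involved, which contradict the lower bounds that shifting `A` and
`B` provides. So `n` can be erased from all members, and induction applies. Equality forces a
common singleton `{p}` in `F` and `G`, a property that is easily carried back through the shifts.

*Equality.* A common singleton puts the compressed sets into the stars at `p` with value `1`; by
cardinality they are equal to these stars. Going back through one compression, only the case where
it acts in position `p` itself is not obvious. There, any two members of `A` are avoided outside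
`p` by some member of `B`, because every `dⱼ` is at least `3`; hence they have the same entry at
`p` (`exists_entry_eq`, `inStars_of_compression`). Finally the stars at `p` and at the first
position are compared by swapping entries (`card_seqStar_eq_iff`).
-/

namespace CrossIntersecting

/-! ### Compressions of finite sets -/

section Compression

variable {α β : Type*} [DecidableEq α] [DecidableEq β]

/-- The compression of `F` along `δ`: every `a ∈ F` is replaced by `δ a`, unless `δ a` is already
in `F`. -/
def compression (δ : α → α) (F : Finset α) : Finset α :=
  F.image fun a => if δ a ∈ F then a else δ a

lemma sum_compression {δ : α → α} (hδ : ∀ a b, δ a ≠ a → δ b ≠ b → δ a = δ b → a = b)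
    (F : Finset α) (f : α → ℕ) :
    ∑ x ∈ compression δ F, f x = ∑ a ∈ F, f (if δ a ∈ F then a else δ a) := by
  unfold compression
  rw [Finset.sum_image]
  intro a ha b hb hab
  simp only at hab
  split_ifs at hab with h1 h2 h2
  · exact hab
  · subst hab; exact absurd ha h2
  · subst hab; exact absurd hb h1
  · exact hδ a b (fun h => h1 (by rwa [h])) (fun h => h2 (by rwa [h])) hab

lemma card_compression {δ : α → α} (hδ : ∀ a b, δ a ≠ a → δ b ≠ b → δ a = δ b → a = b)
    (F : Finset α) : (compression δ F).card = F.card := by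
  simpa using sum_compression hδ F fun _ => 1

lemma mem_of_compression_eq {δ : α → α} {F : Finset α} (h : compression δ F = F) {a : α}
    (ha : a ∈ F) : δ a ∈ F := by
  by_contra hn
  have : δ a ∈ compression δ F := Finset.mem_image.2 ⟨a, ha, by simp [hn]⟩
  exact hn (h ▸ this)

lemma exists_of_mem_compression {δ : α → α} {F : Finset α} {x : α} (hx : x ∈ compression δ F) :
    ∃ a ∈ F, x = a ∨ x = δ a := by
  obtain ⟨a, ha, rfl⟩ := Finset.mem_image.1 hx
  refine ⟨a, ha, ?_⟩
  split_ifs <;> simp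

lemma mem_compression_of_mem {δ : α → α} {F : Finset α} {a : α} (ha : a ∈ F) :
    a ∈ compression δ F ∨ δ a ∈ compression δ F := by
  by_cases h : δ a ∈ F
  · exact Or.inl (Finset.mem_image.2 ⟨a, ha, by simp [h]⟩)
  · exact Or.inr (Finset.mem_image.2 ⟨a, ha, by simp [h]⟩)

lemma sum_compression_le {δ : α → α} (hδ : ∀ a b, δ a ≠ a → δ b ≠ b → δ a = δ b → a = b)
    {f : α → ℕ} (hf : ∀ a, f (δ a) ≤ f a) (F : Finset α) :
    ∑ x ∈ compression δ F, f x ≤ ∑ a ∈ F, f a := by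
  rw [sum_compression hδ]
  refine Finset.sum_le_sum fun a _ => ?_
  split_ifs
  · exact le_rfl
  · exact hf a

lemma sum_compression_lt {δ : α → α} (hδ : ∀ a b, δ a ≠ a → δ b ≠ b → δ a = δ b → a = b)
    {f : α → ℕ} (hf : ∀ a, δ a ≠ a → f (δ a) < f a) {F : Finset α} (hF : compression δ F ≠ F) :
    ∑ x ∈ compression δ F, f x < ∑ a ∈ F, f a := by
  rw [sum_compression hδ]
  have hle : ∀ a, f (δ a) ≤ f a := fun a => by
    by_cases h : δ a = a
    · rw [h]
    · exact (hf a h).le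
  obtain ⟨a, ha, hna⟩ : ∃ a ∈ F, δ a ∉ F := by
    by_contra! hall
    refine hF ?_
    unfold compression
    rw [Finset.image_congr (g := id) fun a ha => by simp [hall a ha], Finset.image_id]
  refine Finset.sum_lt_sum (fun a _ => ?_) ⟨a, ha, ?_⟩
  · split_ifs
    · exact le_rfl
    · exact hle a
  · rw [if_neg hna]
    exact hf a fun h => hna (by rwa [h])

/-- A relation that holds between all members of `F` and all members of `G` survives a
simultaneous compression of `F` and `G`, provided that `δ` and `ε` are compatible with it. -/
lemma cross_compression {R : α → β → Prop} {δ : α → α} {ε : β → β}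
    (h₁ : ∀ a b, R a b → R a (ε b) → R (δ a) b) (h₂ : ∀ a b, R a b → R (δ a) b → R a (ε b))
    (h₃ : ∀ a b, R a b → R (δ a) (ε b)) {F : Finset α} {G : Finset β}
    (h : ∀ a ∈ F, ∀ b ∈ G, R a b) :
    ∀ a ∈ compression δ F, ∀ b ∈ compression ε G, R a b := by
  intro x hx y hy
  obtain ⟨a, ha, rfl⟩ := Finset.mem_image.1 hx
  obtain ⟨b, hb, rfl⟩ := Finset.mem_image.1 hy
  split_ifs with hda heb heb
  · exact h a ha b hb
  · exact h₂ a b (h a ha b hb) (h _ hda b hb)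
  · exact h₁ a b (h a ha b hb) (h a ha _ heb)
  · exact h₃ a b (h a ha b hb)

end Compression

/-! ### Weighted cross-intersecting families -/

/-- Every member of `F` intersects every member of `G`. -/
def CrossInt (F G : Finset (Finset ℕ)) : Prop :=
  ∀ A ∈ F, ∀ B ∈ G, (A ∩ B).Nonempty

lemma CrossInt.symm {F G : Finset (Finset ℕ)} (h : CrossInt F G) : CrossInt G F :=
  fun B hB A hA => by rw [Finset.inter_comm]; exact h A hA B hB

lemma CrossInt.mono {F G F' G' : Finset (Finset ℕ)} (h : CrossInt F G) (hF : F' ⊆ F)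
    (hG : G' ⊆ G) : CrossInt F' G' :=
  fun A hA B hB => h A (hF hA) B (hG hB)

/-- The total weight of a family. -/
def weight (w : Finset ℕ → ℕ) (F : Finset (Finset ℕ)) : ℕ := ∑ A ∈ F, w A

/-- The weight functions to be considered: adding an element to a set at least halves its weight,
and replacing an element by a smaller one does not lower the weight. -/
structure Admissible (w : Finset ℕ → ℕ) : Prop where
  two_mul_le : ∀ A j, j ∉ A → 2 * w (insert j A) ≤ w A
  insert_le : ∀ A i j, i < j → i ∉ A → j ∉ A → w (insert j A) ≤ w (insert i A)

/-- The subsets of `{0, …, n - 1}` that contain `0`. -/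
def starFam (n : ℕ) : Finset (Finset ℕ) := (Finset.range n).powerset.filter fun A => 0 ∈ A

/-- The pair `F`, `G` has the largest product of weights among all cross-intersecting pairs of
families of subsets of `{0, …, n - 1}`. -/
def IsOptimal (n : ℕ) (w v : Finset ℕ → ℕ) (F G : Finset (Finset ℕ)) : Prop :=
  ∀ F' ⊆ (Finset.range n).powerset, ∀ G' ⊆ (Finset.range n).powerset, CrossInt F' G' →
    weight w F' * weight v G' ≤ weight w F * weight v G

lemma IsOptimal.symm {n : ℕ} {w v : Finset ℕ → ℕ} {F G : Finset (Finset ℕ)}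
    (h : IsOptimal n w v F G) : IsOptimal n v w G F := fun G' hG' F' hF' hc => by
  rw [mul_comm, mul_comm (weight v G)]
  exact h F' hF' G' hG' hc.symm

/-- The set obtained from `A` by replacing `j` by `i`, if `A` contains `j` but not `i`. -/
def shiftSet (i j : ℕ) (A : Finset ℕ) : Finset ℕ :=
  if j ∈ A ∧ i ∉ A then insert i (A.erase j) else A

/-- `F` is stable under replacing elements of its members by smaller ones. -/
def Shifted (F : Finset (Finset ℕ)) : Prop :=
  ∀ i j, i < j → ∀ A ∈ F, shiftSet i j A ∈ F

lemma shiftSet_of_mem {i j : ℕ} {A : Finset ℕ} (hj : j ∈ A) (hi : i ∉ A) :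
    shiftSet i j A = insert i (A.erase j) := if_pos ⟨hj, hi⟩

lemma mem_shiftSet_left {i j : ℕ} {A : Finset ℕ} (hj : j ∈ A) (hi : i ∉ A) :
    i ∈ shiftSet i j A := by
  simp [shiftSet_of_mem hj hi]

lemma shiftSet_subset_range {i j n : ℕ} (hij : i < j) {A : Finset ℕ} (hA : A ⊆ Finset.range n) :
    shiftSet i j A ⊆ Finset.range n := by
  unfold shiftSet
  split_ifs with h
  · intro x hx
    rcases Finset.mem_insert.1 hx with rfl | hx
    · have := Finset.mem_range.1 (hA h.1)
      exact Finset.mem_range.2 (hij.trans this)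
    · exact hA (Finset.mem_of_mem_erase hx)
  · exact hA

lemma shiftSet_injective_of_ne {i j : ℕ} (A B : Finset ℕ) (hA : shiftSet i j A ≠ A)
    (hB : shiftSet i j B ≠ B) (h : shiftSet i j A = shiftSet i j B) : A = B := by
  have hA' : j ∈ A ∧ i ∉ A := by by_contra hn; exact hA (if_neg hn)
  have hB' : j ∈ B ∧ i ∉ B := by by_contra hn; exact hB (if_neg hn)
  rw [shiftSet_of_mem hA'.1 hA'.2, shiftSet_of_mem hB'.1 hB'.2] at h
  have h2 : A.erase j = B.erase j := by
    have := congrArg (fun s => s.erase i) h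
    simpa [Finset.erase_insert, hA'.2, hB'.2] using this
  rw [← Finset.insert_erase hA'.1, ← Finset.insert_erase hB'.1, h2]

lemma sum_shiftSet_lt {i j : ℕ} (hij : i < j) {A : Finset ℕ} (hA : shiftSet i j A ≠ A) :
    (shiftSet i j A).sum id < A.sum id := by
  have hA' : j ∈ A ∧ i ∉ A := by by_contra hn; exact hA (if_neg hn)
  rw [shiftSet_of_mem hA'.1 hA'.2, Finset.sum_insert (by simp [hA'.2]),
    ← Finset.add_sum_erase A id hA'.1]
  simpa using hij

lemma inter_shiftSet_nonempty {i j : ℕ} (A B : Finset ℕ) (h : (A ∩ B).Nonempty)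
    (h' : (A ∩ shiftSet i j B).Nonempty) : (shiftSet i j A ∩ B).Nonempty := by
  by_cases hA : j ∈ A ∧ i ∉ A
  · rw [shiftSet_of_mem hA.1 hA.2]
    obtain ⟨x, hx⟩ := h
    obtain ⟨hxA, hxB⟩ := Finset.mem_inter.1 hx
    by_cases hxj : x = j
    · subst hxj
      by_cases hiB : i ∈ B
      · exact ⟨i, by simp [hiB]⟩
      · rw [shiftSet_of_mem hxB hiB] at h'
        obtain ⟨y, hy⟩ := h'
        simp only [Finset.mem_inter, Finset.mem_insert, Finset.mem_erase] at hy
        obtain ⟨hyA, rfl | hyB⟩ := hy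
        · exact absurd hyA hA.2
        · exact ⟨y, by simp [hyA, hyB]⟩
    · exact ⟨x, by simp [hxA, hxB, hxj]⟩
  · rwa [shiftSet, if_neg hA]

lemma shiftSet_inter_shiftSet_nonempty {i j : ℕ} (A B : Finset ℕ) (h : (A ∩ B).Nonempty) :
    (shiftSet i j A ∩ shiftSet i j B).Nonempty := by
  obtain ⟨x, hx⟩ := h
  obtain ⟨hxA, hxB⟩ := Finset.mem_inter.1 hx
  by_cases hxj : x = j
  · subst hxj
    by_cases hiA : i ∈ A <;> by_cases hiB : i ∈ B
    · exact ⟨x, by simp [shiftSet, hiA, hiB, hxA, hxB]⟩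
    all_goals exact ⟨i, by simp [shiftSet, hiA, hiB, hxA, hxB]⟩
  · refine ⟨x, Finset.mem_inter.2 ⟨?_, ?_⟩⟩ <;> unfold shiftSet <;> split_ifs <;> simp [*]

lemma CrossInt.compression {F G : Finset (Finset ℕ)} (h : CrossInt F G) (i j : ℕ) :
    CrossInt (compression (shiftSet i j) F) (compression (shiftSet i j) G) := by
  refine cross_compression (R := fun A B : Finset ℕ => (A ∩ B).Nonempty) (fun A B => ?_)
    (fun A B h1 h2 => ?_) (fun A B => shiftSet_inter_shiftSet_nonempty A B) h
  · exact inter_shiftSet_nonempty A B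
  · rw [Finset.inter_comm] at h1 h2 ⊢
    exact inter_shiftSet_nonempty B A h1 h2

lemma Admissible.le_shiftSet {w : Finset ℕ → ℕ} (hw : Admissible w) {i j : ℕ} (hij : i < j)
    (A : Finset ℕ) : w A ≤ w (shiftSet i j A) := by
  unfold shiftSet
  split_ifs with h
  · conv_lhs => rw [← Finset.insert_erase h.1]
    exact hw.insert_le _ _ _ hij (fun h' => h.2 (Finset.mem_of_mem_erase h')) (by simp)
  · exact le_rfl

lemma Admissible.le_singleton {w : Finset ℕ → ℕ} (hw : Admissible w) {p : ℕ} {A : Finset ℕ}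
    (hp : p ∈ A) : w A ≤ w {p} := by
  have key : ∀ C : Finset ℕ, p ∉ C → w (insert p C) ≤ w {p} := by
    intro C
    induction C using Finset.induction_on with
    | empty => intro _; simp
    | insert a s ha ih =>
      intro hpc
      simp only [Finset.mem_insert, not_or] at hpc
      rw [Finset.insert_comm]
      have := hw.two_mul_le (insert p s) a (by simp [ha, Ne.symm hpc.1])
      have := ih hpc.2
      omega
  rw [← Finset.insert_erase hp]
  exact key _ (by simp)

lemma weight_le_weight_compression {w : Finset ℕ → ℕ} (hw : Admissible w) {i j : ℕ} (hij : i < j)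
    (F : Finset (Finset ℕ)) : weight w F ≤ weight w (compression (shiftSet i j) F) := by
  unfold weight
  rw [sum_compression shiftSet_injective_of_ne]
  refine Finset.sum_le_sum fun A _ => ?_
  split_ifs
  · exact le_rfl
  · exact hw.le_shiftSet hij A

lemma starFam_subset (n : ℕ) : starFam n ⊆ (Finset.range n).powerset := Finset.filter_subset _ _

lemma crossInt_starFam (n : ℕ) : CrossInt (starFam n) (starFam n) := fun _ hA _ hB =>
  ⟨0, Finset.mem_inter.2 ⟨(Finset.mem_filter.1 hA).2, (Finset.mem_filter.1 hB).2⟩⟩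

lemma exists_pos_of_weight_pos {w : Finset ℕ → ℕ} {F : Finset (Finset ℕ)} (h : 0 < weight w F) :
    ∃ A ∈ F, 0 < w A := by
  by_contra! hn
  have : weight w F = 0 := Finset.sum_eq_zero fun A hA => Nat.le_zero.1 (hn A hA)
  omega

/-! ### Optimal shifted pairs -/

/-- In a shifted cross-intersecting pair, two members that meet in the last point only cover
everything: otherwise the last point could be moved out of one of them. -/
lemma mem_of_inter_eq_last {n : ℕ} {F G : Finset (Finset ℕ)} (hc : CrossInt F G) (hF : Shifted F)
    {A B : Finset ℕ} (hA : A ∈ F) (hB : B ∈ G) (hAB : A ∩ B = {n}) {i : ℕ} (hi : i < n)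
    (hiB : i ∉ B) : i ∈ A := by
  by_contra hiA
  have hn : n ∈ A ∩ B := by simp [hAB]
  have hnA := (Finset.mem_inter.1 hn).1
  obtain ⟨x, hx⟩ := hc _ (hF i n hi A hA) B hB
  rw [shiftSet_of_mem hnA hiA] at hx
  simp only [Finset.mem_inter, Finset.mem_insert, Finset.mem_erase] at hx
  obtain ⟨rfl | ⟨hxn, hxA⟩, hxB⟩ := hx
  · exact hiB hxB
  · have : x ∈ A ∩ B := Finset.mem_inter.2 ⟨hxA, hxB⟩
    rw [hAB] at this
    exact hxn (Finset.mem_singleton.1 this)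

/-- The exchange argument: `A` is dropped from `F`, so that `B.erase n`, whose weight is at least
twice that of `B`, can be added to `G`. -/
lemma exchange {n : ℕ} {w v : Finset ℕ → ℕ} (hv : Admissible v) {F G : Finset (Finset ℕ)}
    (hF : F ⊆ (Finset.range (n + 1)).powerset) (hG : G ⊆ (Finset.range (n + 1)).powerset)
    (hc : CrossInt F G) (hsF : Shifted F) (ho : IsOptimal (n + 1) w v F G)
    {A B : Finset ℕ} (hA : A ∈ F) (hB : B ∈ G) (hAB : A ∩ B = {n}) :
    2 * (weight w (F.erase A) * v B) ≤ w A * (weight v (G.erase B) + v B) := by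
  have hn : n ∈ A ∩ B := by simp [hAB]
  obtain ⟨hnA, hnB⟩ := Finset.mem_inter.1 hn
  have hBG : B.erase n ∉ G := by
    intro h
    obtain ⟨x, hx⟩ := hc A hA _ h
    simp only [Finset.mem_inter, Finset.mem_erase] at hx
    have : x ∈ A ∩ B := Finset.mem_inter.2 ⟨hx.1, hx.2.2⟩
    rw [hAB] at this
    exact hx.2.1 (Finset.mem_singleton.1 this)
  have hcross : CrossInt (F.erase A) (insert (B.erase n) G) := by
    intro C hC D hD
    obtain ⟨hCA, hCF⟩ := Finset.mem_erase.1 hC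
    rcases Finset.mem_insert.1 hD with rfl | hD
    · by_contra hemp
      rw [Finset.not_nonempty_iff_eq_empty] at hemp
      -- `C` meets `B` in `n` only, hence `C` is the complement of `B.erase n`, as `A` is
      have hCB : ∀ x, x ∈ C → x ∈ B → x = n := by
        intro x hxC hxB
        by_contra hxn
        have : x ∈ C ∩ B.erase n := by simp [hxC, hxB, hxn]
        rw [hemp] at this
        simp at this
      have hnC : n ∈ C := by
        obtain ⟨x, hx⟩ := hc C hCF B hB
        obtain ⟨hxC, hxB⟩ := Finset.mem_inter.1 hx
        exact hCB x hxC hxB ▸ hxC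
      have hCB' : C ∩ B = {n} := by
        ext x
        simp only [Finset.mem_inter, Finset.mem_singleton]
        exact ⟨fun h => hCB x h.1 h.2, by rintro rfl; exact ⟨hnC, hnB⟩⟩
      have sub : ∀ {C D : Finset ℕ}, C ∈ F → D ∈ F → C ∩ B = {n} → D ∩ B = {n} → C ⊆ D := by
        intro C D hC hD hCB hDB x hx
        have hxn := Finset.mem_range.1 (Finset.mem_powerset.1 (hF hC) hx)
        by_cases hxB : x ∈ B
        · have : x ∈ C ∩ B := Finset.mem_inter.2 ⟨hx, hxB⟩
          rw [hCB, ← hDB] at this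
          exact (Finset.mem_inter.1 this).1
        · have hxn' : x ≠ n := by rintro rfl; exact hxB hnB
          exact mem_of_inter_eq_last hc hsF hD hB hDB (by omega) hxB
      exact hCA ((sub hCF hA hCB' hAB).antisymm (sub hA hCF hAB hCB'))
    · exact hc C hCF D hD
  have h1 := ho (F.erase A) ((Finset.erase_subset _ _).trans hF) (insert (B.erase n) G)
    (Finset.insert_subset (Finset.mem_powerset.2 ((Finset.erase_subset _ _).trans
      (Finset.mem_powerset.1 (hG hB)))) hG) hcross
  have h2 : weight v (insert (B.erase n) G) = v (B.erase n) + weight v G :=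
    Finset.sum_insert hBG
  have h3 : weight w F = w A + weight w (F.erase A) := (Finset.add_sum_erase F w hA).symm
  have h4 : weight v G = v B + weight v (G.erase B) := (Finset.add_sum_erase G v hB).symm
  have h5 := hv.two_mul_le (B.erase n) n (by simp)
  rw [Finset.insert_erase hnB] at h5
  rw [h2, h3, h4] at h1
  have h6 := Nat.mul_le_mul_left (weight w (F.erase A)) h5
  nlinarith

lemma not_inter_eq_last_of_zero_mem {n : ℕ} (hn0 : 0 < n) {w v : Finset ℕ → ℕ}
    (hw : Admissible w) (hv : Admissible v) {F G : Finset (Finset ℕ)}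
    (hF : F ⊆ (Finset.range (n + 1)).powerset) (hG : G ⊆ (Finset.range (n + 1)).powerset)
    (hc : CrossInt F G) (hsF : Shifted F) (hsG : Shifted G) (hwF : ∀ A ∈ F, 0 < w A)
    (hvG : ∀ B ∈ G, 0 < v B) (ho : IsOptimal (n + 1) w v F G)
    {A B : Finset ℕ} (hA : A ∈ F) (hB : B ∈ G) (h0 : 0 ∈ A) : A ∩ B ≠ {n} := by
  intro hAB
  have hn : n ∈ A ∩ B := by simp [hAB]
  obtain ⟨hnA, hnB⟩ := Finset.mem_inter.1 hn
  have hAB' : ∀ x, x ∈ A → x ∈ B → x = n := fun x hxA hxB => by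
    have : x ∈ A ∩ B := Finset.mem_inter.2 ⟨hxA, hxB⟩
    rw [hAB] at this
    exact Finset.mem_singleton.1 this
  have h0B : 0 ∉ B := fun h => by have := hAB' 0 h0 h; omega
  have e1 := exchange (w := w) hv hF hG hc hsF ho hA hB hAB
  have e2 := exchange (w := v) hw hG hF hc.symm hsG ho.symm hB hA
    (by rw [Finset.inter_comm]; exact hAB)
  have hα := hwF A hA
  have hβ := hvG B hB
  have hαβ := Nat.mul_pos hα hβ
  have hB₁ : shiftSet 0 n B ∈ G.erase B :=
    Finset.mem_erase.2 ⟨fun h => h0B (h ▸ mem_shiftSet_left hnB h0B), hsG 0 n hn0 B hB⟩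
  have hvB₁ := hv.le_shiftSet hn0 B
  by_cases hb : ∃ b ∈ B, b ≠ n
  · obtain ⟨b, hbB, hbn⟩ := hb
    have hb0 : 0 < b := Nat.pos_of_ne_zero fun h => h0B (h ▸ hbB)
    have hbn' : b < n := by
      have := Finset.mem_range.1 (Finset.mem_powerset.1 (hG hB) hbB); omega
    have hbA : b ∉ A := fun h => hbn (hAB' b h hbB)
    have hA₁ : shiftSet b n A ∈ F.erase A :=
      Finset.mem_erase.2 ⟨fun h => hbA (h ▸ mem_shiftSet_left hnA hbA), hsF b n hbn' A hA⟩
    have hx : w A ≤ weight w (F.erase A) :=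
      (hw.le_shiftSet hbn' A).trans (Finset.single_le_sum (f := w) (fun _ _ => Nat.zero_le _) hA₁)
    have hB₂ : shiftSet 0 b B ∈ G.erase B :=
      Finset.mem_erase.2 ⟨fun h => h0B (h ▸ mem_shiftSet_left hbB h0B), hsG 0 b hb0 B hB⟩
    have hne : shiftSet 0 n B ≠ shiftSet 0 b B := by
      rw [shiftSet_of_mem hnB h0B, shiftSet_of_mem hbB h0B]
      intro h
      have : n ∈ insert 0 (B.erase b) := by simp [hnB, Ne.symm hbn]
      rw [← h] at this
      simp at this
      omega
    have hy : 2 * v B ≤ weight v (G.erase B) := by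
      have hsub : ({shiftSet 0 n B, shiftSet 0 b B} : Finset (Finset ℕ)) ⊆ G.erase B :=
        Finset.insert_subset hB₁ (Finset.singleton_subset_iff.2 hB₂)
      have := Finset.sum_le_sum_of_subset (f := v) hsub
      rw [Finset.sum_pair hne] at this
      have := hv.le_shiftSet hb0 B
      unfold weight
      omega
    have := Nat.mul_le_mul_right (v B) hx
    have := Nat.mul_le_mul_right (w A) hy
    nlinarith
  · -- here `B = {n}`, so `G` contains all singletons and `A` is the only member of `F`
    push Not at hb
    have hBn : B = {n} := Finset.eq_singleton_iff_unique_mem.2 ⟨hnB, hb⟩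
    have hfull : ∀ C ∈ F, C = Finset.range (n + 1) := by
      intro C hC
      refine (Finset.mem_powerset.1 (hF hC)).antisymm fun i hi => ?_
      have hiG : {i} ∈ G := by
        rcases Nat.lt_succ_iff_lt_or_eq.1 (Finset.mem_range.1 hi) with h | rfl
        · have := hsG i n h B hB
          rwa [shiftSet_of_mem hnB (by simp [hBn]; omega), hBn, Finset.erase_singleton] at this
        · exact hBn ▸ hB
      obtain ⟨x, hx⟩ := hc C hC _ hiG
      simp only [Finset.mem_inter, Finset.mem_singleton] at hx
      exact hx.2 ▸ hx.1
    have hx : weight w (F.erase A) = 0 := by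
      have : F.erase A = ∅ := by
        rw [Finset.eq_empty_iff_forall_notMem]
        intro C hC
        obtain ⟨hCA, hC⟩ := Finset.mem_erase.1 hC
        exact hCA ((hfull C hC).trans (hfull A hA).symm)
      rw [this]; rfl
    have hy : v B ≤ weight v (G.erase B) :=
      hvB₁.trans (Finset.single_le_sum (f := v) (fun _ _ => Nat.zero_le _) hB₁)
    have := Nat.mul_le_mul_right (w A) hy
    rw [hx] at e2
    nlinarith

/-- In an optimal shifted pair without members of weight zero, no two members meet in the last
point only. -/
lemma inter_ne_last {n : ℕ} (hn0 : 0 < n) {w v : Finset ℕ → ℕ}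
    (hw : Admissible w) (hv : Admissible v) {F G : Finset (Finset ℕ)}
    (hF : F ⊆ (Finset.range (n + 1)).powerset) (hG : G ⊆ (Finset.range (n + 1)).powerset)
    (hc : CrossInt F G) (hsF : Shifted F) (hsG : Shifted G) (hwF : ∀ A ∈ F, 0 < w A)
    (hvG : ∀ B ∈ G, 0 < v B) (ho : IsOptimal (n + 1) w v F G)
    {A B : Finset ℕ} (hA : A ∈ F) (hB : B ∈ G) : A ∩ B ≠ {n} := by
  by_cases h0B : 0 ∈ B
  · rw [Finset.inter_comm]
    exact not_inter_eq_last_of_zero_mem hn0 hv hw hG hF hc.symm hsG hsF hvG hwF ho.symm hB hA h0B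
  · intro hAB
    exact not_inter_eq_last_of_zero_mem hn0 hw hv hF hG hc hsF hsG hwF hvG ho hA hB
      (mem_of_inter_eq_last hc hsF hA hB hAB hn0 h0B) hAB

/-- The weight of `T ⊆ {0, …, n - 1}` is the total weight of the subsets of `{0, …, n}` that
agree with `T` up to `n`; other sets get weight zero. -/
def forgetLast (n : ℕ) (w : Finset ℕ → ℕ) (T : Finset ℕ) : ℕ :=
  if T ⊆ Finset.range n then w T + w (insert n T) else 0

lemma Admissible.forgetLast {w : Finset ℕ → ℕ} (hw : Admissible w) (n : ℕ) :
    Admissible (forgetLast n w) := by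
  constructor
  · intro A j hj
    unfold CrossIntersecting.forgetLast
    by_cases h : insert j A ⊆ Finset.range n
    · have hA := (Finset.subset_insert _ _).trans h
      have hjn : j ≠ n := by
        have := Finset.mem_range.1 (h (Finset.mem_insert_self j A)); omega
      rw [if_pos h, if_pos hA, Finset.insert_comm]
      have := hw.two_mul_le A j hj
      have := hw.two_mul_le (insert n A) j (by simp [hj, hjn])
      omega
    · rw [if_neg h]; omega
  · intro A i j hij hi hj
    unfold CrossIntersecting.forgetLast
    by_cases h : insert j A ⊆ Finset.range n
    · have hjn := Finset.mem_range.1 (h (Finset.mem_insert_self j A))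
      have h' : insert i A ⊆ Finset.range n := Finset.insert_subset
        (Finset.mem_range.2 (hij.trans hjn)) ((Finset.subset_insert _ _).trans h)
      rw [if_pos h, if_pos h', Finset.insert_comm n j, Finset.insert_comm n i]
      have := hw.insert_le A i j hij hi hj
      have := hw.insert_le (insert n A) i j hij (by simp [hi]; omega) (by simp [hj]; omega)
      omega
    · rw [if_neg h]; omega

lemma weight_starFam_forgetLast {n : ℕ} (hn : 0 < n) (w : Finset ℕ → ℕ) :
    weight (forgetLast n w) (starFam n) = weight w (starFam (n + 1)) := by
  unfold weight starFam
  rw [Finset.range_add_one, Finset.sum_filter, Finset.sum_filter,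
    Finset.sum_powerset_insert (by simp), ← Finset.sum_add_distrib]
  refine Finset.sum_congr rfl fun T hT => ?_
  have h0 : 0 ∈ insert n T ↔ 0 ∈ T := by simp [hn.ne]
  simp only [h0, forgetLast, if_pos (Finset.mem_powerset.1 hT)]
  split_ifs <;> simp

lemma weight_le_weight_forgetLast {n : ℕ} (w : Finset ℕ → ℕ) {F : Finset (Finset ℕ)}
    (hF : F ⊆ (Finset.range (n + 1)).powerset) :
    weight w F ≤ weight (forgetLast n w) (F.image fun A => A.erase n) := by
  unfold weight
  rw [← Finset.sum_fiberwise_of_maps_to (t := F.image fun A => A.erase n)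
    (g := fun A => A.erase n) (fun A hA => Finset.mem_image_of_mem _ hA)]
  refine Finset.sum_le_sum fun T hT => ?_
  obtain ⟨A, hA, rfl⟩ := Finset.mem_image.1 hT
  have hsub : A.erase n ⊆ Finset.range n := by
    intro x hx
    obtain ⟨hxn, hxA⟩ := Finset.mem_erase.1 hx
    have := Finset.mem_range.1 (Finset.mem_powerset.1 (hF hA) hxA)
    exact Finset.mem_range.2 (by omega)
  rw [forgetLast, if_pos hsub, ← Finset.sum_pair (f := w) (fun h => by
    have : n ∈ A.erase n := h ▸ Finset.mem_insert_self _ _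
    simp at this)]
  refine Finset.sum_le_sum_of_subset fun C hC => ?_
  obtain ⟨-, hC⟩ := Finset.mem_filter.1 hC
  rw [Finset.mem_insert, Finset.mem_singleton, ← hC]
  by_cases hn : n ∈ C
  · exact Or.inr (Finset.insert_erase hn).symm
  · exact Or.inl (Finset.erase_eq_of_notMem hn).symm

/-! ### The weighted theorem -/

/-- The bound for the product of the weights, and the shape of the pairs that attain it. -/
def WeightedBound (n : ℕ) (w v : Finset ℕ → ℕ) (F G : Finset (Finset ℕ)) : Prop :=
  weight w F * weight v G ≤ weight w (starFam n) * weight v (starFam n) ∧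
    (weight w F * weight v G = weight w (starFam n) * weight v (starFam n) →
      0 < weight w F * weight v G → ∃ p, {p} ∈ F ∧ {p} ∈ G)

/-- If all members contain `p`, then `{p}` could be added to `F`, and has positive weight since it
weighs at least as much as any member of `F`. -/
lemma singleton_mem_of_isOptimal {n : ℕ} {w v : Finset ℕ → ℕ} (hw : Admissible w)
    {F G : Finset (Finset ℕ)} (hF : F ⊆ (Finset.range n).powerset)
    (hG : G ⊆ (Finset.range n).powerset) (hc : CrossInt F G) (ho : IsOptimal n w v F G)
    (hpos : 0 < weight w F * weight v G) {p : ℕ} (hpF : ∀ A ∈ F, p ∈ A) (hpG : ∀ B ∈ G, p ∈ B) :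
    {p} ∈ F := by
  by_contra hp
  obtain ⟨A, hA, hwA⟩ := exists_pos_of_weight_pos (Nat.pos_of_mul_pos_right hpos)
  have hwp : 0 < w {p} := hwA.trans_le (hw.le_singleton (hpF A hA))
  have hpn : {p} ⊆ Finset.range n :=
    Finset.singleton_subset_iff.2 (Finset.mem_powerset.1 (hF hA) (hpF A hA))
  have h1 := ho (insert {p} F) (Finset.insert_subset (Finset.mem_powerset.2 hpn) hF) G hG (by
    intro C hC D hD
    rcases Finset.mem_insert.1 hC with rfl | hC
    · exact ⟨p, by simp [hpG D hD]⟩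
    · exact hc C hC D hD)
  have h2 : weight w (insert {p} F) = w {p} + weight w F := Finset.sum_insert hp
  rw [h2, add_mul] at h1
  have := Nat.mul_pos hwp (Nat.pos_of_mul_pos_left hpos)
  omega

/-- The induction step: erasing the last point from all members keeps the pair cross-intersecting,
so the bound for `forgetLast n w` and `forgetLast n v` applies. -/
lemma weightedBound_of_shifted {n : ℕ} (hn0 : 0 < n)
    (ih : ∀ w v, Admissible w → Admissible v → ∀ F ⊆ (Finset.range n).powerset,
      ∀ G ⊆ (Finset.range n).powerset, CrossInt F G → WeightedBound n w v F G)
    {w v : Finset ℕ → ℕ}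
    (hw : Admissible w) (hv : Admissible v) {F G : Finset (Finset ℕ)}
    (hF : F ⊆ (Finset.range (n + 1)).powerset) (hG : G ⊆ (Finset.range (n + 1)).powerset)
    (hc : CrossInt F G) (hsF : Shifted F) (hsG : Shifted G) (hwF : ∀ A ∈ F, 0 < w A)
    (hvG : ∀ B ∈ G, 0 < v B) (ho : IsOptimal (n + 1) w v F G) :
    WeightedBound (n + 1) w v F G := by
  have himg : ∀ {F : Finset (Finset ℕ)}, F ⊆ (Finset.range (n + 1)).powerset →
      F.image (fun A => A.erase n) ⊆ (Finset.range n).powerset := by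
    intro F hF T hT
    obtain ⟨A, hA, rfl⟩ := Finset.mem_image.1 hT
    refine Finset.mem_powerset.2 fun x hx => ?_
    obtain ⟨hxn, hxA⟩ := Finset.mem_erase.1 hx
    have := Finset.mem_range.1 (Finset.mem_powerset.1 (hF hA) hxA)
    exact Finset.mem_range.2 (by omega)
  have hc' : CrossInt (F.image fun A => A.erase n) (G.image fun A => A.erase n) := by
    intro A' hA' B' hB'
    obtain ⟨A, hA, rfl⟩ := Finset.mem_image.1 hA'
    obtain ⟨B, hB, rfl⟩ := Finset.mem_image.1 hB'
    by_contra hemp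
    refine inter_ne_last hn0 hw hv hF hG hc hsF hsG hwF hvG ho hA hB ?_
    refine Finset.eq_singleton_iff_nonempty_unique_mem.2 ⟨hc A hA B hB, fun x hx => ?_⟩
    obtain ⟨hxA, hxB⟩ := Finset.mem_inter.1 hx
    by_contra hxn
    exact hemp ⟨x, by simp [hxA, hxB, hxn]⟩
  obtain ⟨hle, heq⟩ := ih _ _ (hw.forgetLast n) (hv.forgetLast n) _ (himg hF) _ (himg hG) hc'
  have hprod := Nat.mul_le_mul (weight_le_weight_forgetLast w hF) (weight_le_weight_forgetLast v hG)
  rw [weight_starFam_forgetLast hn0, weight_starFam_forgetLast hn0] at hle heq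
  have hstar := ho _ (starFam_subset _) _ (starFam_subset _) (crossInt_starFam _)
  refine ⟨hprod.trans hle, fun _ hpos => ?_⟩
  obtain ⟨p, hpF, hpG⟩ := heq (le_antisymm hle (hstar.trans hprod)) (hpos.trans_le hprod)
  have hmem : ∀ {F G : Finset (Finset ℕ)},
      CrossInt (F.image fun A => A.erase n) (G.image fun A => A.erase n) →
      {p} ∈ F.image (fun A => A.erase n) → ∀ B ∈ G, p ∈ B := by
    intro F G hc hp B hB
    obtain ⟨x, hx⟩ := hc _ hp _ (Finset.mem_image_of_mem _ hB)
    simp only [Finset.mem_inter, Finset.mem_singleton, Finset.mem_erase] at hx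
    exact hx.1 ▸ hx.2.2
  have hG' := hmem hc' hpF
  have hF' := hmem hc'.symm hpG
  exact ⟨p, singleton_mem_of_isOptimal hw hF hG hc ho hpos hF' hG',
    singleton_mem_of_isOptimal hv hG hF hc.symm ho.symm (by rwa [mul_comm]) hG' hF'⟩

/-- A common singleton survives undoing a shift. -/
lemma exists_singleton_of_compression {i j : ℕ} {F G : Finset (Finset ℕ)} (hc : CrossInt F G)
    {p : ℕ} (hF : {p} ∈ compression (shiftSet i j) F) (hG : {p} ∈ compression (shiftSet i j) G) :
    ∃ q, {q} ∈ F ∧ {q} ∈ G := by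
  have key : ∀ {F : Finset (Finset ℕ)}, {p} ∈ compression (shiftSet i j) F →
      {p} ∈ F ∨ (p = i ∧ {j} ∈ F) := by
    intro F hF
    obtain ⟨A, hA, h | h⟩ := exists_of_mem_compression hF
    · exact Or.inl (h ▸ hA)
    · by_cases hA' : j ∈ A ∧ i ∉ A
      · rw [shiftSet_of_mem hA'.1 hA'.2] at h
        have hi : i = p := Finset.mem_singleton.1 (h ▸ Finset.mem_insert_self _ _)
        refine Or.inr ⟨hi.symm, ?_⟩
        convert hA using 1
        refine (Finset.eq_singleton_iff_unique_mem.2 ⟨hA'.1, fun x hx => ?_⟩).symm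
        by_contra hxj
        have : x ∈ ({p} : Finset ℕ) := h ▸ (by simp [hx, hxj])
        rw [Finset.mem_singleton] at this
        exact hA'.2 (hi ▸ this ▸ hx)
      · rw [shiftSet, if_neg hA'] at h
        exact Or.inl (h ▸ hA)
  have hmeet : ∀ {x y : ℕ}, {x} ∈ F → {y} ∈ G → x = y := by
    intro x y hx hy
    obtain ⟨z, hz⟩ := hc _ hx _ hy
    simp only [Finset.mem_inter, Finset.mem_singleton] at hz
    exact hz.1.symm.trans hz.2
  rcases key hF with h1 | ⟨-, h1⟩ <;> rcases key hG with h2 | ⟨-, h2⟩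
  · exact ⟨p, h1, h2⟩
  · exact ⟨p, h1, hmeet h1 h2 ▸ h2⟩
  · exact ⟨p, hmeet h1 h2 ▸ h1, h2⟩
  · exact ⟨j, h1, h2⟩

lemma shift_subset_powerset {i j n : ℕ} (hij : i < j) {F : Finset (Finset ℕ)}
    (hF : F ⊆ (Finset.range n).powerset) :
    compression (shiftSet i j) F ⊆ (Finset.range n).powerset := by
  intro x hx
  obtain ⟨A, hA, rfl | rfl⟩ := exists_of_mem_compression hx
  · exact hF hA
  · exact Finset.mem_powerset.2 (shiftSet_subset_range hij (Finset.mem_powerset.1 (hF hA)))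

lemma pos_of_mem_compression {w : Finset ℕ → ℕ} (hw : Admissible w) {i j : ℕ} (hij : i < j)
    {F : Finset (Finset ℕ)} (hwF : ∀ A ∈ F, 0 < w A) :
    ∀ A ∈ compression (shiftSet i j) F, 0 < w A := by
  intro x hx
  obtain ⟨A, hA, rfl | rfl⟩ := exists_of_mem_compression hx
  · exact hwF _ hA
  · exact (hwF A hA).trans_le (hw.le_shiftSet hij A)

lemma weightedBound_of_pos {n : ℕ} (hn0 : 0 < n)
    (ih : ∀ w v, Admissible w → Admissible v → ∀ F ⊆ (Finset.range n).powerset,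
      ∀ G ⊆ (Finset.range n).powerset, CrossInt F G → WeightedBound n w v F G)
    {w v : Finset ℕ → ℕ} (hw : Admissible w) (hv : Admissible v) (F G : Finset (Finset ℕ))
    (hF : F ⊆ (Finset.range (n + 1)).powerset) (hG : G ⊆ (Finset.range (n + 1)).powerset)
    (hc : CrossInt F G) (hwF : ∀ A ∈ F, 0 < w A)
    (hvG : ∀ B ∈ G, 0 < v B) (ho : IsOptimal (n + 1) w v F G) :
    WeightedBound (n + 1) w v F G := by
  induction hk : (∑ A ∈ F, A.sum id) + ∑ B ∈ G, B.sum id using Nat.strong_induction_on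
    generalizing F G with
  | _ k IH =>
  by_cases hall : ∀ i j, i < j →
      compression (shiftSet i j) F = F ∧ compression (shiftSet i j) G = G
  · exact weightedBound_of_shifted hn0 ih hw hv hF hG hc
      (fun i j hij A hA => mem_of_compression_eq (hall i j hij).1 hA)
      (fun i j hij A hA => mem_of_compression_eq (hall i j hij).2 hA) hwF hvG ho
  · push Not at hall
    obtain ⟨i, j, hij, hne⟩ := hall
    have hlt : ∀ A, shiftSet i j A ≠ A → (shiftSet i j A).sum id < A.sum id :=
      fun A => sum_shiftSet_lt hij
    have hle : ∀ A, (shiftSet i j A).sum id ≤ A.sum id := fun A => by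
      by_cases h : shiftSet i j A = A
      · rw [h]
      · exact (hlt A h).le
    have hdec : (∑ A ∈ compression (shiftSet i j) F, A.sum id) +
        ∑ B ∈ compression (shiftSet i j) G, B.sum id < k := by
      rw [← hk]
      by_cases h : compression (shiftSet i j) F = F
      · exact add_lt_add_of_le_of_lt (sum_compression_le shiftSet_injective_of_ne hle F)
          (sum_compression_lt shiftSet_injective_of_ne hlt (hne h))
      · exact add_lt_add_of_lt_of_le (sum_compression_lt shiftSet_injective_of_ne hlt h)
          (sum_compression_le shiftSet_injective_of_ne hle G)
    have hprod := Nat.mul_le_mul (weight_le_weight_compression hw hij F)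
      (weight_le_weight_compression hv hij G)
    have hF' := shift_subset_powerset hij hF
    have hG' := shift_subset_powerset hij hG
    obtain ⟨h1, h2⟩ := IH _ hdec (compression (shiftSet i j) F) (compression (shiftSet i j) G)
      hF' hG' (hc.compression i j) (pos_of_mem_compression hw hij hwF)
      (pos_of_mem_compression hv hij hvG)
      (fun F₁ hF₁ G₁ hG₁ hc₁ => (ho F₁ hF₁ G₁ hG₁ hc₁).trans hprod) rfl
    refine ⟨hprod.trans h1, fun heq hpos => ?_⟩
    obtain ⟨p, hp1, hp2⟩ := h2 (le_antisymm h1 (heq ▸ hprod)) (hpos.trans_le hprod)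
    exact exists_singleton_of_compression hc hp1 hp2

lemma weightedBound_of_isOptimal {n : ℕ} (hn0 : 0 < n)
    (ih : ∀ w v, Admissible w → Admissible v → ∀ F ⊆ (Finset.range n).powerset,
      ∀ G ⊆ (Finset.range n).powerset, CrossInt F G → WeightedBound n w v F G)
    {w v : Finset ℕ → ℕ} (hw : Admissible w) (hv : Admissible v) {F G : Finset (Finset ℕ)}
    (hF : F ⊆ (Finset.range (n + 1)).powerset) (hG : G ⊆ (Finset.range (n + 1)).powerset)
    (hc : CrossInt F G) (ho : IsOptimal (n + 1) w v F G) :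
    WeightedBound (n + 1) w v F G := by
  have hfil : ∀ (w : Finset ℕ → ℕ) (F : Finset (Finset ℕ)),
      weight w (F.filter fun A => 0 < w A) = weight w F := fun w F =>
    Finset.sum_filter_of_ne fun A _ h => Nat.pos_of_ne_zero h
  have h := weightedBound_of_pos hn0 ih hw hv (F.filter fun A => 0 < w A)
    (G.filter fun B => 0 < v B) ((Finset.filter_subset _ _).trans hF)
    ((Finset.filter_subset _ _).trans hG)
    (hc.mono (Finset.filter_subset _ _) (Finset.filter_subset _ _))
    (fun A hA => (Finset.mem_filter.1 hA).2) (fun A hA => (Finset.mem_filter.1 hA).2)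
    (fun F' hF' G' hG' hc' => by rw [hfil, hfil]; exact ho F' hF' G' hG' hc')
  unfold WeightedBound at h ⊢
  rw [hfil, hfil] at h
  refine ⟨h.1, fun h1 h2 => ?_⟩
  obtain ⟨p, hp1, hp2⟩ := h.2 h1 h2
  exact ⟨p, Finset.mem_of_mem_filter _ hp1, Finset.mem_of_mem_filter _ hp2⟩

lemma weightedBound_of_le_one {n : ℕ} (hn : n ≤ 1) (w v : Finset ℕ → ℕ)
    {F G : Finset (Finset ℕ)} (hF : F ⊆ (Finset.range n).powerset)
    (hG : G ⊆ (Finset.range n).powerset) (hc : CrossInt F G) : WeightedBound n w v F G := by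
  rcases Nat.eq_zero_or_pos (weight w F * weight v G) with h | hpos
  · exact ⟨by omega, by omega⟩
  have hz : ∀ {F : Finset (Finset ℕ)}, F ⊆ (Finset.range n).powerset →
      ∀ A ∈ F, ∀ x ∈ A, x = 0 := by
    intro F hF A hA x hx
    have := Finset.mem_range.1 (Finset.mem_powerset.1 (hF hA) hx)
    omega
  obtain ⟨A, hA, -⟩ := exists_pos_of_weight_pos (Nat.pos_of_mul_pos_right hpos)
  obtain ⟨B, hB, -⟩ := exists_pos_of_weight_pos (Nat.pos_of_mul_pos_left hpos)
  have key : ∀ {F G : Finset (Finset ℕ)}, F ⊆ (Finset.range n).powerset → CrossInt F G →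
      ∀ A ∈ F, ∀ B ∈ G, 0 ∈ A := by
    intro F G hF hc A hA B hB
    obtain ⟨x, hx⟩ := hc A hA B hB
    have hxA := (Finset.mem_inter.1 hx).1
    exact hz hF A hA x hxA ▸ hxA
  have hsub : ∀ {F G : Finset (Finset ℕ)}, F ⊆ (Finset.range n).powerset → CrossInt F G →
      ∀ B ∈ G, F ⊆ starFam n := fun hF hc B hB A hA =>
    Finset.mem_filter.2 ⟨hF hA, key hF hc A hA B hB⟩
  refine ⟨Nat.mul_le_mul (Finset.sum_le_sum_of_subset (hsub hF hc B hB))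
    (Finset.sum_le_sum_of_subset (hsub hG hc.symm A hA)), fun _ _ => ⟨0, ?_, ?_⟩⟩
  · convert hA using 1
    exact (Finset.eq_singleton_iff_unique_mem.2 ⟨key hF hc A hA B hB, hz hF A hA⟩).symm
  · convert hB using 1
    exact (Finset.eq_singleton_iff_unique_mem.2 ⟨key hG hc.symm B hB A hA, hz hG B hB⟩).symm

/-- The product of the weights of two cross-intersecting families is at most that of the stars at
the first point, and it is attained only by families that share a singleton. -/
theorem weightedBound (n : ℕ) : ∀ w v, Admissible w → Admissible v →
    ∀ F ⊆ (Finset.range n).powerset, ∀ G ⊆ (Finset.range n).powerset, CrossInt F G →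
      WeightedBound n w v F G := by
  induction n with
  | zero => exact fun w v _ _ F hF G hG hc => weightedBound_of_le_one (by omega) w v hF hG hc
  | succ n ih =>
    intro w v hw hv F hF G hG hc
    rcases Nat.eq_zero_or_pos n with rfl | hn0
    · exact weightedBound_of_le_one le_rfl w v hF hG hc
    classical
    obtain ⟨⟨F₀, G₀⟩, h₀, hmax⟩ := Finset.exists_max_image
      (((Finset.range (n + 1)).powerset.powerset ×ˢ (Finset.range (n + 1)).powerset.powerset).filter
        fun P => CrossInt P.1 P.2) (fun P => weight w P.1 * weight v P.2)
      ⟨(F, G), by simp only [Finset.mem_filter, Finset.mem_product, Finset.mem_powerset]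
                  exact ⟨⟨hF, hG⟩, hc⟩⟩
    simp only [Finset.mem_filter, Finset.mem_product, Finset.mem_powerset] at h₀ hmax
    have ho : IsOptimal (n + 1) w v F₀ G₀ := fun F' hF' G' hG' hc' =>
      hmax (F', G') ⟨⟨hF', hG'⟩, hc'⟩
    have hb := (weightedBound_of_isOptimal hn0 ih hw hv h₀.1.1 h₀.1.2 h₀.2 ho).1
    have hbF := (ho F hF G hG hc).trans hb
    refine ⟨hbF, fun heq hpos => ?_⟩
    have ho' : IsOptimal (n + 1) w v F G := fun F' hF' G' hG' hc' =>
      (ho F' hF' G' hG' hc').trans (heq ▸ hb)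
    exact (weightedBound_of_isOptimal hn0 ih hw hv hF hG hc ho').2 heq hpos

/-! ### Entries of sequences -/

section Entries

variable {m n : ℕ}

/-- The sequence `a`, continued by zeros. -/
def ext (a : Fin n → ℕ) (i : ℕ) : ℕ := if h : i < n then a ⟨i, h⟩ else 0

lemma ext_val (a : Fin n → ℕ) (j : Fin n) : ext a j = a j := by simp [ext]

lemma lt_of_ext_ne_zero {a : Fin n → ℕ} {i : ℕ} (h : ext a i ≠ 0) : i < n := by
  by_contra hn
  exact h (dif_neg hn)

lemma meets_iff {a : Fin m → ℕ} {b : Fin n → ℕ} :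
    Meets a b ↔ ∃ i, ext a i = ext b i ∧ ext a i ≠ 0 := by
  constructor
  · rintro ⟨i, j, hij, hab, h0⟩
    refine ⟨i, ?_, by rwa [ext_val]⟩
    rw [ext_val, hij, ext_val, hab]
  · rintro ⟨i, hab, h0⟩
    have hm := lt_of_ext_ne_zero h0
    have hn := lt_of_ext_ne_zero (hab ▸ h0)
    rw [ext, dif_pos hm] at hab h0
    rw [ext, dif_pos hn] at hab
    exact ⟨⟨i, hm⟩, ⟨i, hn⟩, rfl, hab, h0⟩

lemma meets_symm {a : Fin m → ℕ} {b : Fin n → ℕ} (h : Meets a b) : Meets b a := by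
  obtain ⟨i, j, hij, hab, h0⟩ := h
  exact ⟨j, i, hij.symm, hab.symm, hab ▸ h0⟩

/-- The sequence obtained from `a` by replacing the entry in position `i` by `1` if it is `k`. -/
def setOne (i k : ℕ) (a : Fin n → ℕ) : Fin n → ℕ :=
  fun j => if (j : ℕ) = i ∧ a j = k then 1 else a j

lemma ext_setOne {k : ℕ} (hk : 2 ≤ k) (i : ℕ) (a : Fin n → ℕ) (x : ℕ) :
    ext (setOne i k a) x = if x = i ∧ ext a x = k then 1 else ext a x := by
  unfold ext setOne
  split_ifs <;> simp_all
  omega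

lemma setOne_injective_of_ne {i k : ℕ} (a b : Fin n → ℕ) (ha : setOne i k a ≠ a)
    (hb : setOne i k b ≠ b) (h : setOne i k a = setOne i k b) : a = b := by
  have key : ∀ a : Fin n → ℕ, setOne i k a ≠ a → ∀ j : Fin n, (j : ℕ) = i → a j = k := by
    intro a ha j hj
    by_contra hak
    refine ha (funext fun x => ?_)
    unfold setOne
    split_ifs with hx
    · exact absurd (Fin.ext (hx.1.trans hj.symm) ▸ hx.2) hak
    · rfl
  funext j
  by_cases hj : (j : ℕ) = i
  · rw [key a ha j hj, key b hb j hj]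
  · simpa [setOne, hj] using congrFun h j

lemma sum_setOne_lt {i k : ℕ} (hk : 2 ≤ k) (a : Fin n → ℕ) (ha : setOne i k a ≠ a) :
    ∑ j, setOne i k a j < ∑ j, a j := by
  have hle : ∀ j, setOne i k a j ≤ a j := fun j => by
    unfold setOne; split_ifs with h
    · omega
    · exact le_rfl
  obtain ⟨j, hj⟩ := Function.ne_iff.1 ha
  exact Finset.sum_lt_sum (fun j _ => hle j) ⟨j, Finset.mem_univ _, lt_of_le_of_ne (hle j) hj⟩

lemma meets_setOne {i k : ℕ} (hk : 2 ≤ k) (a : Fin m → ℕ) (b : Fin n → ℕ) (h : Meets a b)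
    (h' : Meets a (setOne i k b)) : Meets (setOne i k a) b := by
  rw [meets_iff] at *
  simp only [ext_setOne hk] at *
  obtain ⟨x, hx, hx0⟩ := h
  obtain ⟨y, hy, hy0⟩ := h'
  by_cases hxk : x = i ∧ ext a x = k
  · refine ⟨y, ?_, ?_⟩ <;> grind
  · exact ⟨x, by rwa [if_neg hxk], by rwa [if_neg hxk]⟩

lemma setOne_meets_setOne {i k : ℕ} (hk : 2 ≤ k) (a : Fin m → ℕ) (b : Fin n → ℕ)
    (h : Meets a b) : Meets (setOne i k a) (setOne i k b) := by
  rw [meets_iff] at *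
  simp only [ext_setOne hk]
  obtain ⟨x, hx, hx0⟩ := h
  exact ⟨x, by rw [hx], by split_ifs <;> simp [hx0]⟩

lemma meets_compression {i k : ℕ} (hk : 2 ≤ k) {A : Finset (Fin m → ℕ)} {B : Finset (Fin n → ℕ)}
    (h : ∀ a ∈ A, ∀ b ∈ B, Meets a b) :
    ∀ a ∈ compression (setOne i k) A, ∀ b ∈ compression (setOne i k) B, Meets a b :=
  cross_compression (meets_setOne hk)
    (fun a b h1 h2 => meets_symm (meets_setOne hk b a (meets_symm h1) (meets_symm h2)))
    (setOne_meets_setOne hk) h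

/-- The positions at which `a` has the entry `1`. -/
def ones (a : Fin n → ℕ) : Finset ℕ := (Finset.range n).filter fun i => ext a i = 1

lemma mem_ones {a : Fin n → ℕ} {i : ℕ} : i ∈ ones a ↔ ext a i = 1 := by
  simp only [ones, Finset.mem_filter, Finset.mem_range, and_iff_right_iff_imp]
  intro h
  exact lt_of_ext_ne_zero (a := a) (by omega)

lemma ones_subset_range (a : Fin n → ℕ) : ones a ⊆ Finset.range n := Finset.filter_subset _ _

/-- If `A` is closed under changing entries to `1`, then its members meet those of `B` in entries
`1`: all other common entries can be destroyed one after the other. -/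
lemma ones_inter_ones_nonempty {A : Finset (Fin m → ℕ)} {B : Finset (Fin n → ℕ)}
    (h : ∀ a ∈ A, ∀ b ∈ B, Meets a b) (hA : ∀ i k, 2 ≤ k → ∀ a ∈ A, setOne i k a ∈ A)
    {a : Fin m → ℕ} (ha : a ∈ A) {b : Fin n → ℕ} (hb : b ∈ B) : (ones a ∩ ones b).Nonempty := by
  induction hk : ∑ j, a j using Nat.strong_induction_on generalizing a with
  | _ s IH =>
  obtain ⟨i, hi, hi0⟩ := meets_iff.1 (h a ha b hb)
  by_cases h1 : ext a i = 1
  · exact ⟨i, Finset.mem_inter.2 ⟨mem_ones.2 h1, mem_ones.2 (hi ▸ h1)⟩⟩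
  · have h2 : 2 ≤ ext a i := by omega
    have hne : setOne i (ext a i) a ≠ a := fun he => by
      have := ext_setOne h2 i a i
      rw [he] at this
      simp only [and_self, if_true] at this
      exact h1 this
    obtain ⟨x, hx⟩ := IH _ (hk ▸ sum_setOne_lt h2 a hne) (hA i _ h2 a ha) rfl
    rw [Finset.mem_inter, mem_ones, mem_ones, ext_setOne h2] at hx
    refine ⟨x, Finset.mem_inter.2 ⟨mem_ones.2 ?_, mem_ones.2 hx.2⟩⟩
    grind

end Entries

/-! ### Partial sequences -/

section PartialSeqs

variable {n : ℕ} {c : Fin n → ℕ} {r : ℕ}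

lemma mem_partialSeqs {a : Fin n → ℕ} : a ∈ partialSeqs c r ↔
    (∀ i, a i ≤ c i) ∧ (Finset.univ.filter fun i => a i ≠ 0).card = r := by
  simp [partialSeqs, Fintype.mem_piFinset]

lemma mem_seqStar {p : Fin n} {q : ℕ} {a : Fin n → ℕ} :
    a ∈ seqStar c r p q ↔ a ∈ partialSeqs c r ∧ a p = q := Finset.mem_filter

lemma update_mem_partialSeqs {a : Fin n → ℕ} (ha : a ∈ partialSeqs c r) {j : Fin n} {e : ℕ}
    (haj : a j ≠ 0) (he : e ≠ 0) (hec : e ≤ c j) : Function.update a j e ∈ partialSeqs c r := by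
  rw [mem_partialSeqs] at *
  constructor
  · intro i
    by_cases hi : i = j
    · subst hi; simpa using hec
    · simpa [hi] using ha.1 i
  · rw [← ha.2]
    congr 1
    ext i
    by_cases hi : i = j
    · subst hi; simp [haj, he]
    · simp [hi]

lemma swap_mem_partialSeqs {a : Fin n → ℕ} (ha : a ∈ partialSeqs c r) {i j : Fin n}
    (hij : a i ≤ c j) (hji : a j ≤ c i) : a ∘ Equiv.swap i j ∈ partialSeqs c r := by
  rw [mem_partialSeqs] at *
  constructor
  · intro x
    simp only [Function.comp]
    rcases eq_or_ne x i with rfl | hxi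
    · simpa using hji
    rcases eq_or_ne x j with rfl | hxj
    · simpa using hij
    rw [Equiv.swap_apply_of_ne_of_ne hxi hxj]
    exact ha.1 x
  · rw [← ha.2]
    refine Finset.card_bij (fun x _ => Equiv.swap i j x) (by simp) (by simp) fun x hx => ?_
    exact ⟨Equiv.swap i j x, by simpa using hx, by simp⟩

lemma setOne_mem_partialSeqs (hc : ∀ i, 1 ≤ c i) {i k : ℕ} (hk : 2 ≤ k) {a : Fin n → ℕ}
    (ha : a ∈ partialSeqs c r) : setOne i k a ∈ partialSeqs c r := by
  rw [mem_partialSeqs] at *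
  constructor
  · intro j
    unfold setOne
    split_ifs
    · exact hc j
    · exact ha.1 j
  · rw [← ha.2]
    congr 1
    ext j
    simp only [Finset.mem_filter, Finset.mem_univ, true_and]
    unfold setOne
    split_ifs with h
    · exact ⟨fun _ => by omega, fun _ => one_ne_zero⟩
    · rfl

lemma compression_subset_partialSeqs (hc : ∀ i, 1 ≤ c i) {i k : ℕ} (hk : 2 ≤ k)
    {A : Finset (Fin n → ℕ)} (hA : A ⊆ partialSeqs c r) :
    compression (setOne i k) A ⊆ partialSeqs c r := by
  intro x hx
  obtain ⟨a, ha, rfl | rfl⟩ := exists_of_mem_compression hx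
  · exact hA ha
  · exact setOne_mem_partialSeqs hc hk (hA ha)

/-- There is a partial sequence whose positive entries are those of `g`, and whose support
contains a given set of at most `r` positions. -/
lemma exists_mem_partialSeqs (hr : r ≤ n) {J : Finset (Fin n)} (hJ : J.card ≤ r) {g : Fin n → ℕ}
    (hg : ∀ i, 1 ≤ g i) (hgc : ∀ i, g i ≤ c i) :
    ∃ y ∈ partialSeqs c r, (∀ i ∈ J, y i = g i) ∧ ∀ i, y i = 0 ∨ y i = g i := by
  obtain ⟨I, hJI, -, hI⟩ := Finset.exists_subsuperset_card_eq (Finset.subset_univ J) hJ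
    (by simpa using hr)
  refine ⟨fun i => if i ∈ I then g i else 0, mem_partialSeqs.2 ⟨fun i => ?_, ?_⟩,
    fun i hi => if_pos (hJI hi), fun i => ?_⟩
  · split_ifs
    · exact hgc i
    · omega
  · rw [← hI]
    congr 1
    ext i
    simpa using fun _ => Nat.one_le_iff_ne_zero.1 (hg i)
  · dsimp only
    split_ifs <;> simp

/-- Since `cⱼ ≥ 3`, some sequence in the star at `p` avoids any two given sequences off `p`. -/
lemma exists_mem_seqStar_avoiding (hc : ∀ i, 3 ≤ c i) (hr : 1 ≤ r) (hrn : r ≤ n) (p : Fin n)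
    (f g : ℕ → ℕ) : ∃ y ∈ seqStar c r p 1,
      ∀ i, i ≠ (p : ℕ) → ext y i ≠ 0 → ext y i ≠ f i ∧ ext y i ≠ g i := by
  have hex : ∀ x z : ℕ, ∃ e, 1 ≤ e ∧ e ≤ 3 ∧ e ≠ x ∧ e ≠ z := by
    intro x z
    by_contra! h
    have h1 := h 1 le_rfl (by omega)
    have h2 := h 2 (by omega) (by omega)
    have h3 := h 3 (by omega) le_rfl
    omega
  choose e he1 he3 hex hez using hex
  obtain ⟨y, hy, hyp, hyi⟩ := exists_mem_partialSeqs (c := c) hrn (J := {p}) (by simpa using hr)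
    (g := fun i => if i = p then 1 else e (f i) (g i))
    (fun i => by split_ifs; exacts [le_rfl, he1 _ _])
    (fun i => by
      split_ifs
      exacts [(by omega : 1 ≤ 3).trans (hc i), (he3 _ _).trans (hc i)])
  refine ⟨y, mem_seqStar.2 ⟨hy, by simpa using hyp p (by simp)⟩, fun i hip hi0 => ?_⟩
  have hin := lt_of_ext_ne_zero hi0
  rw [ext, dif_pos hin] at hi0 ⊢
  have hne : (⟨i, hin⟩ : Fin n) ≠ p := fun h => hip (congrArg Fin.val h)
  have := (hyi ⟨i, hin⟩).resolve_left hi0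
  rw [if_neg hne] at this
  rw [this]
  exact ⟨hex _ _, hez _ _⟩

lemma seqStar_nonempty (hc : ∀ i, 3 ≤ c i) (hr : 1 ≤ r) (hrn : r ≤ n) (p : Fin n) :
    (seqStar c r p 1).Nonempty :=
  let ⟨y, hy, _⟩ := exists_mem_seqStar_avoiding hc hr hrn p 0 0
  ⟨y, hy⟩

/-! ### Sizes of stars -/

lemma card_seqStar_le_of_value {p : Fin n} {q q' : ℕ} (hq : 1 ≤ q) (hq' : 1 ≤ q')
    (hq'c : q' ≤ c p) : (seqStar c r p q).card ≤ (seqStar c r p q').card := by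
  refine Finset.card_le_card_of_injOn (fun a => Function.update a p q') ?_ ?_
  · intro a ha
    obtain ⟨ha, hap⟩ := mem_seqStar.1 ha
    exact mem_seqStar.2 ⟨update_mem_partialSeqs ha (by omega) (by omega) hq'c, by simp⟩
  · intro a ha b hb hab
    have ha := (mem_seqStar.1 ha).2
    have hb := (mem_seqStar.1 hb).2
    have := congrArg (fun f => Function.update f p q) hab
    simp only [Function.update_idem] at this
    rwa [← ha, Function.update_eq_self, ha, ← hb, Function.update_eq_self] at this

lemma swap_injective (i j : Fin n) : Function.Injective fun a : Fin n → ℕ => a ∘ Equiv.swap i j :=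
  (Equiv.surjective _).injective_comp_right

lemma swap_mem_seqStar {i j : Fin n} (hij : c i ≤ c j) (hi : 1 ≤ c i) {a : Fin n → ℕ}
    (ha : a ∈ seqStar c r j 1) : a ∘ Equiv.swap i j ∈ seqStar c r i 1 := by
  obtain ⟨ha, haj⟩ := mem_seqStar.1 ha
  refine mem_seqStar.2 ⟨swap_mem_partialSeqs ha (((mem_partialSeqs.1 ha).1 i).trans hij)
    (by omega), by simpa using haj⟩

lemma card_seqStar_le_of_le {i j : Fin n} (hij : c i ≤ c j) (hi : 1 ≤ c i) :
    (seqStar c r j 1).card ≤ (seqStar c r i 1).card :=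
  Finset.card_le_card_of_injOn _ (fun _ ha => swap_mem_seqStar hij hi ha)
    (swap_injective i j).injOn

lemma card_seqStar_lt_of_lt {i j : Fin n} (hij : c i < c j) (hc : ∀ i, 1 ≤ c i) (hr : 2 ≤ r)
    (hrn : r ≤ n) : (seqStar c r j 1).card < (seqStar c r i 1).card := by
  have hne : j ≠ i := by rintro rfl; omega
  obtain ⟨y, hy, hyJ, -⟩ := exists_mem_partialSeqs (c := c) hrn (J := {i, j})
    (by rw [Finset.card_pair hne.symm]; exact hr)
    (g := fun x => if x = i then 1 else c x)
    (fun x => by split_ifs; exacts [le_rfl, hc x])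
    (fun x => by split_ifs; exacts [hc x, le_rfl])
  have hyi : y i = 1 := by simpa using hyJ i (by simp)
  have hyj : y j = c j := by simpa [hne] using hyJ j (by simp)
  rw [← Finset.card_image_of_injective (seqStar c r j 1) (swap_injective i j)]
  refine Finset.card_lt_card ((Finset.ssubset_iff_of_subset ?_).2
    ⟨y, mem_seqStar.2 ⟨hy, hyi⟩, ?_⟩)
  · intro x hx
    obtain ⟨a, ha, rfl⟩ := Finset.mem_image.1 hx
    exact swap_mem_seqStar hij.le (hc i) ha
  · intro h
    obtain ⟨a, ha, rfl⟩ := Finset.mem_image.1 h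
    have := (mem_partialSeqs.1 (mem_seqStar.1 ha).1).1 i
    simp only [Function.comp, Equiv.swap_apply_right] at hyj
    omega

lemma eq_zero_of_mem_partialSeqs_one {a : Fin n → ℕ} (ha : a ∈ partialSeqs c 1) {i j : Fin n}
    (hij : i ≠ j) (hi : a i ≠ 0) : a j = 0 := by
  obtain ⟨x, hx⟩ := Finset.card_eq_one.1 (mem_partialSeqs.1 ha).2
  by_contra hj
  have h1 : i ∈ ({x} : Finset (Fin n)) := hx ▸ (by simp [hi])
  have h2 : j ∈ ({x} : Finset (Fin n)) := hx ▸ (by simp [hj])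
  rw [Finset.mem_singleton] at h1 h2
  exact hij (h1.trans h2.symm)

variable [NeZero n]

lemma card_seqStar_le (hc : IsIPSeq c) {p : Fin n} {q : ℕ} (hq : 1 ≤ q) :
    (seqStar c r p q).card ≤ (seqStar c r 0 1).card :=
  (card_seqStar_le_of_value hq le_rfl (hc.1 p)).trans
    (card_seqStar_le_of_le (hc.2 (Fin.zero_le _)) (hc.1 0))

lemma card_seqStar_eq_iff (hc : IsIPSeq c) (hr : 1 ≤ r) (hrn : r ≤ n) {p : Fin n} {q : ℕ}
    (hq : 1 ≤ q) (hqc : q ≤ c p) :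
    (seqStar c r p q).card = (seqStar c r 0 1).card ↔ r = 1 ∨ c p = c 0 := by
  have hpq : (seqStar c r p q).card = (seqStar c r p 1).card :=
    le_antisymm (card_seqStar_le_of_value hq le_rfl (hc.1 p))
      (card_seqStar_le_of_value le_rfl hq hqc)
  rw [hpq]
  constructor
  · intro h
    by_contra! hn
    have := card_seqStar_lt_of_lt (r := r) (lt_of_le_of_ne (hc.2 (Fin.zero_le p)) hn.2.symm) hc.1
      (by omega) hrn
    omega
  · rintro (rfl | h)
    · refine le_antisymm (card_seqStar_le hc le_rfl) ?_
      refine Finset.card_le_card_of_injOn _ (fun a ha => ?_) (swap_injective p 0).injOn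
      obtain ⟨ha, ha0⟩ := mem_seqStar.1 ha
      refine mem_seqStar.2 ⟨swap_mem_partialSeqs ha ?_ (ha0.trans_le (hc.1 p)), by simpa using ha0⟩
      rcases eq_or_ne p 0 with rfl | hp
      · exact (mem_partialSeqs.1 ha).1 0
      · rw [eq_zero_of_mem_partialSeqs_one ha hp.symm (by omega)]
        exact Nat.zero_le _
    · exact le_antisymm (card_seqStar_le_of_le h.ge (hc.1 0)) (card_seqStar_le_of_le h.le (hc.1 p))

lemma card_seqStar_eq_starSum (hc : IsIPSeq c) (hr : 1 ≤ r) :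
    (seqStar c r 0 1).card = starSum c r := by
  have hmaps : ∀ a ∈ seqStar c r 0 1, (Finset.univ.filter fun i => a i ≠ 0).erase 0 ∈
      Finset.powersetCard (r - 1) (Finset.univ.erase (0 : Fin n)) := by
    intro a ha
    obtain ⟨ha, ha0⟩ := mem_seqStar.1 ha
    rw [Finset.mem_powersetCard, Finset.card_erase_of_mem (by simp [ha0]), (mem_partialSeqs.1 ha).2]
    exact ⟨Finset.erase_subset_erase _ (Finset.subset_univ _), rfl⟩
  rw [Finset.card_eq_sum_card_fiberwise hmaps, starSum]
  refine Finset.sum_congr rfl fun I hI => ?_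
  obtain ⟨hI, hIc⟩ := Finset.mem_powersetCard.1 hI
  have h0I : (0 : Fin n) ∉ I := fun h => by simpa using hI h
  have hfib : (seqStar c r 0 1).filter (fun a => (Finset.univ.filter fun i => a i ≠ 0).erase 0 = I)
      = Fintype.piFinset fun i => if i = 0 then {1} else if i ∈ I then Finset.Icc 1 (c i)
        else {0} := by
    ext a
    simp only [Finset.mem_filter, mem_seqStar, mem_partialSeqs, Fintype.mem_piFinset]
    constructor
    · rintro ⟨⟨⟨hac, -⟩, ha0⟩, rfl⟩ i
      split_ifs with hi hiI
      · subst hi; simp [ha0]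
      · simp only [Finset.mem_erase, Finset.mem_filter, Finset.mem_univ, true_and] at hiI
        exact Finset.mem_Icc.2 ⟨Nat.one_le_iff_ne_zero.2 hiI.2, hac i⟩
      · simpa [hi] using hiI
    · intro h
      have ha0 : a 0 = 1 := by simpa using h 0
      have haI : ∀ i ∈ I, 1 ≤ a i ∧ a i ≤ c i := fun i hi => by
        have := h i
        rwa [if_neg (by rintro rfl; exact h0I hi), if_pos hi, Finset.mem_Icc] at this
      have hae : ∀ i, i ≠ 0 → i ∉ I → a i = 0 := fun i hi hiI => by
        have := h i
        rwa [if_neg hi, if_neg hiI, Finset.mem_singleton] at this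
      have hsupp : (Finset.univ.filter fun i => a i ≠ 0) = insert 0 I := by
        ext i
        simp only [Finset.mem_filter, Finset.mem_univ, true_and, Finset.mem_insert]
        constructor
        · intro hi
          by_contra! hn
          exact hi (hae i hn.1 hn.2)
        · rintro (rfl | hi)
          · omega
          · have := (haI i hi).1; omega
      refine ⟨⟨⟨fun i => ?_, ?_⟩, ha0⟩, ?_⟩
      · rcases eq_or_ne i 0 with rfl | hi0
        · rw [ha0]; exact hc.1 0
        by_cases hi : i ∈ I
        · exact (haI i hi).2
        · rw [hae i hi0 hi]; exact Nat.zero_le _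
      · rw [hsupp, Finset.card_insert_of_notMem h0I, hIc]; omega
      · rw [hsupp, Finset.erase_insert h0I]
  rw [hfib, Fintype.card_piFinset, ← Finset.mul_prod_erase _ _ (Finset.mem_univ 0)]
  simp only [if_true, Finset.card_singleton, one_mul]
  rw [← Finset.prod_subset hI fun i hi hiI => by
    rw [if_neg (Finset.ne_of_mem_erase hi), if_neg hiI, Finset.card_singleton]]
  refine Finset.prod_congr rfl fun i hi => ?_
  rw [if_neg (by rintro rfl; exact h0I hi), if_pos hi, Nat.card_Icc]
  omega

end PartialSeqs

/-! ### The weight of a set of positions -/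

section Weights

variable {n : ℕ}

/-- The number of sequences in `S_c^{(r)}` whose entries `1` are in the positions `T`. -/
def seqWeight (c : Fin n → ℕ) (r : ℕ) (T : Finset ℕ) : ℕ :=
  ((partialSeqs c r).filter fun a => ones a = T).card

lemma ext_update (a : Fin n → ℕ) (j : Fin n) (e x : ℕ) :
    ext (Function.update a j e) x = if x = j then e else ext a x := by
  split_ifs with h
  · subst h; rw [ext_val]; simp
  · unfold ext
    split_ifs with hx
    · rw [Function.update_of_ne]
      intro h'
      exact h (congrArg Fin.val h')
    · rfl

lemma ext_swap (a : Fin n → ℕ) (i j : Fin n) (x : ℕ) :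
    ext (a ∘ Equiv.swap i j) x = if x = i then a j else if x = j then a i else ext a x := by
  split_ifs with hi hj
  · subst hi; rw [ext_val]; simp
  · subst hj; rw [ext_val]; simp
  · unfold ext
    split_ifs with hx
    · simp only [Function.comp]
      rw [Equiv.swap_apply_of_ne_of_ne]
      · intro h'; exact hi (congrArg Fin.val h')
      · intro h'; exact hj (congrArg Fin.val h')
    · rfl

lemma seqWeight_eq_zero {c : Fin n → ℕ} {r : ℕ} {T : Finset ℕ} {j : ℕ} (hj : j ∈ T)
    (hjn : n ≤ j) : seqWeight c r T = 0 := by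
  rw [seqWeight, Finset.card_eq_zero, Finset.filter_eq_empty_iff]
  rintro a - rfl
  have := Finset.mem_range.1 (ones_subset_range a hj)
  omega

lemma admissible_seqWeight {c : Fin n → ℕ} (hmono : Monotone c) (hc : ∀ i, 3 ≤ c i) (r : ℕ) :
    Admissible (seqWeight c r) := by
  constructor
  · intro T j hj
    rcases le_or_gt n j with hjn | hjn
    · rw [seqWeight_eq_zero (Finset.mem_insert_self j T) hjn]; omega
    obtain ⟨j, rfl⟩ : ∃ j' : Fin n, (j' : ℕ) = j := ⟨⟨j, hjn⟩, rfl⟩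
    -- the entry `1` in position `j` can be changed to `2` or `3`
    have h2 : ({2, 3} : Finset ℕ).card = 2 := rfl
    rw [seqWeight, seqWeight, ← h2, ← Finset.card_product]
    have hone : ∀ {a : Fin n → ℕ}, ones a = insert (j : ℕ) T → a j = 1 := fun {a} h => by
      rw [← ext_val a j]; exact mem_ones.1 (h ▸ Finset.mem_insert_self _ _)
    refine Finset.card_le_card_of_injOn (fun P => Function.update P.2 j P.1) ?_ ?_
    · rintro ⟨e, a⟩ h
      simp only [Finset.coe_product, Set.mem_prod, Finset.mem_coe, Finset.mem_filter] at h
      obtain ⟨he, ha, ho⟩ := h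
      have haj := hone ho
      have he' : e = 2 ∨ e = 3 := by simpa using he
      have hcj := hc j
      refine Finset.mem_coe.2 (Finset.mem_filter.2
        ⟨update_mem_partialSeqs ha (by omega) (by omega) (by omega), ?_⟩)
      ext x
      have hx : ext a x = 1 ↔ x = j ∨ x ∈ T := by rw [← mem_ones, ho, Finset.mem_insert]
      rw [mem_ones, ext_update]
      split_ifs with hxj
      · subst hxj
        exact ⟨fun h => by omega, fun h => absurd h hj⟩
      · rw [hx]; simp [hxj]
    · rintro ⟨e, a⟩ h ⟨e', a'⟩ h' heq
      simp only [Finset.coe_product, Set.mem_prod, Finset.mem_coe, Finset.mem_filter] at h h'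
      simp only at heq
      have h1 : e = e' := by simpa using congrFun heq j
      have h3 := congrArg (fun f => Function.update f j 1) heq
      simp only [Function.update_idem] at h3
      have e1 := Function.update_eq_self j a
      have e2 := Function.update_eq_self j a'
      rw [hone h.2.2] at e1
      rw [hone h'.2.2] at e2
      rw [e1, e2] at h3
      rw [h1, h3]
  · intro T i j hij hi hj
    rcases le_or_gt n j with hjn | hjn
    · rw [seqWeight_eq_zero (Finset.mem_insert_self j T) hjn]; omega
    obtain ⟨i, rfl⟩ : ∃ i' : Fin n, (i' : ℕ) = i := ⟨⟨i, hij.trans hjn⟩, rfl⟩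
    obtain ⟨j, rfl⟩ : ∃ j' : Fin n, (j' : ℕ) = j := ⟨⟨j, hjn⟩, rfl⟩
    refine Finset.card_le_card_of_injOn _ ?_ (swap_injective i j).injOn
    intro a h
    obtain ⟨ha, ho⟩ := Finset.mem_filter.1 (Finset.mem_coe.1 h)
    have hx : ∀ x, ext a x = 1 ↔ x = j ∨ x ∈ T := fun x => by
      rw [← mem_ones, ho, Finset.mem_insert]
    have haj : a j = 1 := by rw [← ext_val a j, hx]; exact Or.inl rfl
    have hai : a i ≠ 1 := by
      rw [← ext_val a i, Ne, hx]
      rintro (h | h)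
      · omega
      · exact hi h
    have hci := hc i
    refine Finset.mem_coe.2 (Finset.mem_filter.2 ⟨swap_mem_partialSeqs ha
      (((mem_partialSeqs.1 ha).1 i).trans (hmono hij.le)) (by omega), ?_⟩)
    ext x
    rw [mem_ones, ext_swap, Finset.mem_insert]
    split_ifs with hxi hxj
    · simp [hxi, haj]
    · subst hxj
      simp [hai, hxi, hj]
    · rw [hx]; simp [hxi, hxj]

lemma card_le_weight {c : Fin n → ℕ} {r : ℕ} {A : Finset (Fin n → ℕ)} (hA : A ⊆ partialSeqs c r) :
    A.card ≤ weight (seqWeight c r) (A.image ones) := by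
  rw [Finset.card_eq_sum_card_fiberwise (f := ones) (t := A.image ones)
    fun a ha => Finset.mem_coe.2 (Finset.mem_image_of_mem _ ha)]
  exact Finset.sum_le_sum fun T _ => Finset.card_le_card (Finset.filter_subset_filter _ hA)

lemma weight_starFam [NeZero n] (c : Fin n → ℕ) (r : ℕ) {N : ℕ} (hN : n ≤ N) :
    weight (seqWeight c r) (starFam N) = (seqStar c r 0 1).card := by
  have h0 : ∀ a : Fin n → ℕ, 0 ∈ ones a ↔ a 0 = 1 := fun a => by
    rw [mem_ones, ← ext_val a 0]; simp
  rw [Finset.card_eq_sum_card_fiberwise (f := ones) (t := starFam N)]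
  · refine Finset.sum_congr rfl fun T hT => ?_
    have hT0 := (Finset.mem_filter.1 hT).2
    rw [seqWeight]
    congr 1
    ext a
    simp only [Finset.mem_filter, mem_seqStar]
    constructor
    · rintro ⟨h1, rfl⟩; exact ⟨⟨h1, (h0 a).1 hT0⟩, rfl⟩
    · rintro ⟨⟨h1, -⟩, h2⟩; exact ⟨h1, h2⟩
  · intro a ha
    refine Finset.mem_coe.2 (Finset.mem_filter.2 ⟨Finset.mem_powerset.2
      ((ones_subset_range a).trans (Finset.range_subset_range.2 hN)), (h0 a).2 ?_⟩)
    exact (mem_seqStar.1 (Finset.mem_coe.1 ha)).2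

end Weights

/-! ### Cross-intersecting sets of sequences -/

section Main

variable {m n : ℕ}

/-- If compressing `B` yields a full star at `p`, then two sequences that meet all members of `B`
have the same entry in position `p`: some member of `B` avoids both of them in all other
positions. -/
lemma exists_entry_eq {d : Fin n → ℕ} {s : ℕ} (hd : ∀ i, 3 ≤ d i) (hs : 1 ≤ s) (hsn : s ≤ n)
    {k : ℕ} (hk : 2 ≤ k) {p : Fin m} {p' : Fin n} (hp : (p : ℕ) = p') {B : Finset (Fin n → ℕ)}
    (hB : seqStar d s p' 1 ⊆ compression (setOne (p' : ℕ) k) B) {a₁ a₂ : Fin m → ℕ}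
    (h₁ : ∀ b ∈ B, Meets a₁ b) (h₂ : ∀ b ∈ B, Meets a₂ b) :
    ∃ b ∈ B, b p' = a₁ p ∧ b p' = a₂ p := by
  obtain ⟨y, hy, hav⟩ := exists_mem_seqStar_avoiding hd hs hsn p' (ext a₁) (ext a₂)
  obtain ⟨b, hb, hyb⟩ := exists_of_mem_compression (hB hy)
  have hoff : ∀ x, x ≠ (p' : ℕ) → ext b x = ext y x := by
    intro x hx
    rcases hyb with rfl | rfl
    · rfl
    · rw [ext_setOne hk, if_neg fun h => hx h.1]
  have key : ∀ a : Fin m → ℕ, (∀ x, x ≠ (p' : ℕ) → ext y x ≠ 0 → ext y x ≠ ext a x) →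
      Meets a b → b p' = a p := by
    intro a ha hm
    obtain ⟨x, hx, hx0⟩ := meets_iff.1 hm
    by_cases hxp : x = p'
    · rw [hxp, ext_val, ← hp, ext_val] at hx
      exact hx.symm
    · rw [hx, hoff x hxp] at hx0
      rw [hoff x hxp] at hx
      exact absurd hx.symm (ha x hxp hx0)
  exact ⟨b, hb, key a₁ (fun x hx h0 => (hav x hx h0).1) (h₁ b hb),
    key a₂ (fun x hx h0 => (hav x hx h0).2) (h₂ b hb)⟩

/-- `A` and `B` lie in stars at the same position and with the same positive value. -/
def InStars (c : Fin m → ℕ) (d : Fin n → ℕ) (r s : ℕ) (A : Finset (Fin m → ℕ))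
    (B : Finset (Fin n → ℕ)) : Prop :=
  ∃ (p : Fin m) (p' : Fin n) (q : ℕ), (p : ℕ) = p' ∧ 1 ≤ q ∧ A ⊆ seqStar c r p q ∧
    B ⊆ seqStar d s p' q

lemma subset_seqStar_of_compression {c : Fin n → ℕ} {r i k q : ℕ} {p : Fin n}
    {A : Finset (Fin n → ℕ)} (hA : A ⊆ partialSeqs c r)
    (h : compression (setOne i k) A ⊆ seqStar c r p q) (hne : ¬((p : ℕ) = i ∧ q = 1)) :
    A ⊆ seqStar c r p q := by
  intro a ha
  refine mem_seqStar.2 ⟨hA ha, ?_⟩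
  rcases mem_compression_of_mem (δ := setOne i k) ha with h' | h'
  · exact (mem_seqStar.1 (h h')).2
  · have := (mem_seqStar.1 (h h')).2
    unfold setOne at this
    split_ifs at this with hcond
    · exact absurd ⟨hcond.1, this.symm⟩ hne
    · exact this

lemma entry_pos_of_compression {c : Fin n → ℕ} {r k : ℕ} (hk : 2 ≤ k) {p : Fin n}
    {A : Finset (Fin n → ℕ)} (h : compression (setOne (p : ℕ) k) A ⊆ seqStar c r p 1)
    {a : Fin n → ℕ} (ha : a ∈ A) : 1 ≤ a p := by
  rcases mem_compression_of_mem (δ := setOne (p : ℕ) k) ha with h' | h'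
  · exact (mem_seqStar.1 (h h')).2.ge
  · have := (mem_seqStar.1 (h h')).2
    unfold setOne at this
    split_ifs at this with hcond <;> omega

/-- Being contained in stars survives undoing a compression to full stars. -/
lemma inStars_of_compression {c : Fin m → ℕ} {d : Fin n → ℕ} {r s : ℕ} (hc : ∀ i, 3 ≤ c i)
    (hd : ∀ i, 3 ≤ d i) (hr : 1 ≤ r) (hrm : r ≤ m) (hs : 1 ≤ s) (hsn : s ≤ n)
    {A : Finset (Fin m → ℕ)} {B : Finset (Fin n → ℕ)} (hA : A ⊆ partialSeqs c r)
    (hB : B ⊆ partialSeqs d s) (hAB : ∀ a ∈ A, ∀ b ∈ B, Meets a b) (hA0 : A.Nonempty)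
    {i k : ℕ} (hk : 2 ≤ k) {p : Fin m} {p' : Fin n} {q : ℕ} (hp : (p : ℕ) = p') (hq : 1 ≤ q)
    (hA' : compression (setOne i k) A = seqStar c r p q)
    (hB' : compression (setOne i k) B = seqStar d s p' q) : InStars c d r s A B := by
  by_cases hcase : (p : ℕ) = i ∧ q = 1
  · obtain ⟨rfl, rfl⟩ := hcase
    obtain ⟨a₀, ha₀⟩ := hA0
    rw [hp] at hB'
    refine ⟨p, p', a₀ p, hp, entry_pos_of_compression hk hA'.le ha₀, fun a ha => ?_, fun b hb => ?_⟩
    · obtain ⟨b, -, h1, h2⟩ := exists_entry_eq hd hs hsn hk hp hB'.ge (hAB a ha) (hAB a₀ ha₀)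
      exact mem_seqStar.2 ⟨hA ha, h1.symm.trans h2⟩
    · obtain ⟨a, ha, h1, -⟩ := exists_entry_eq hc hr hrm hk hp.symm hA'.ge
        (fun a ha => meets_symm (hAB a ha b hb)) (fun a ha => meets_symm (hAB a ha b hb))
      obtain ⟨b', -, h2, h3⟩ := exists_entry_eq hd hs hsn hk hp hB'.ge (hAB a ha) (hAB a₀ ha₀)
      exact mem_seqStar.2 ⟨hB hb, by rw [← h1, ← h2, h3]⟩
  · exact ⟨p, p', q, hp, hq, subset_seqStar_of_compression hA hA'.le hcase,
      subset_seqStar_of_compression hB hB'.le (hp ▸ hcase)⟩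

lemma eq_and_eq_of_mul_le {x y X Y : ℕ} (hx : x ≤ X) (hy : y ≤ Y) (hX : 0 < X) (hY : 0 < Y)
    (h : X * Y ≤ x * y) : x = X ∧ y = Y := by
  constructor
  · by_contra hne
    have h1 : x + 1 ≤ X := by omega
    have := Nat.mul_le_mul_right Y h1
    have := Nat.mul_le_mul_left x hy
    nlinarith
  · by_contra hne
    have h1 : y + 1 ≤ Y := by omega
    have := Nat.mul_le_mul_left X h1
    have := Nat.mul_le_mul_right y hx
    nlinarith

/-- If `|A||B|` has the extremal value and `A`, `B` lie in stars, then they are these stars. -/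
lemma eq_seqStar_of_card [NeZero m] [NeZero n] {c : Fin m → ℕ} {d : Fin n → ℕ} {r s : ℕ}
    (hc : IsIPSeq c) (hd : IsIPSeq d) {p : Fin m} {p' : Fin n} {q : ℕ} (hq : 1 ≤ q)
    {A : Finset (Fin m → ℕ)} {B : Finset (Fin n → ℕ)} (hA : A ⊆ seqStar c r p q)
    (hB : B ⊆ seqStar d s p' q) (hpos : 0 < (seqStar c r 0 1).card * (seqStar d s 0 1).card)
    (hcard : A.card * B.card = (seqStar c r 0 1).card * (seqStar d s 0 1).card) :
    (A = seqStar c r p q ∧ B = seqStar d s p' q) ∧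
      (seqStar c r p q).card = (seqStar c r 0 1).card ∧
      (seqStar d s p' q).card = (seqStar d s 0 1).card := by
  have h1 := Finset.card_le_card hA
  have h2 := Finset.card_le_card hB
  have h3 := card_seqStar_le (r := r) hc (p := p) hq
  have h4 := card_seqStar_le (r := s) hd (p := p') hq
  obtain ⟨h5, h6⟩ := eq_and_eq_of_mul_le (h1.trans h3) (h2.trans h4)
    (Nat.pos_of_mul_pos_right hpos) (Nat.pos_of_mul_pos_left hpos) hcard.ge
  exact ⟨⟨Finset.eq_of_subset_of_card_le hA (by omega),
    Finset.eq_of_subset_of_card_le hB (by omega)⟩, by omega, by omega⟩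

/-- The theorem for sets that are closed under changing entries to `1`. -/
lemma card_bound_of_stable [NeZero m] [NeZero n] {c : Fin m → ℕ} {d : Fin n → ℕ} {r s : ℕ}
    (hcm : Monotone c) (hdm : Monotone d) (hc : ∀ i, 3 ≤ c i) (hd : ∀ i, 3 ≤ d i)
    (hpos : 0 < (seqStar c r 0 1).card * (seqStar d s 0 1).card)
    {A : Finset (Fin m → ℕ)} {B : Finset (Fin n → ℕ)} (hA : A ⊆ partialSeqs c r)
    (hB : B ⊆ partialSeqs d s) (hAB : ∀ a ∈ A, ∀ b ∈ B, Meets a b)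
    (hsA : ∀ i k, 2 ≤ k → ∀ a ∈ A, setOne i k a ∈ A) :
    A.card * B.card ≤ (seqStar c r 0 1).card * (seqStar d s 0 1).card ∧
      (A.card * B.card = (seqStar c r 0 1).card * (seqStar d s 0 1).card →
        InStars c d r s A B) := by
  have hsub : ∀ {l : ℕ} (_ : l ≤ max m n) (A : Finset (Fin l → ℕ)),
      A.image ones ⊆ (Finset.range (max m n)).powerset := by
    intro l hl A T hT
    obtain ⟨a, -, rfl⟩ := Finset.mem_image.1 hT
    exact Finset.mem_powerset.2 ((ones_subset_range a).trans (Finset.range_subset_range.2 hl))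
  have hcross : CrossInt (A.image ones) (B.image ones) := by
    intro T hT U hU
    obtain ⟨a, ha, rfl⟩ := Finset.mem_image.1 hT
    obtain ⟨b, hb, rfl⟩ := Finset.mem_image.1 hU
    exact ones_inter_ones_nonempty hAB hsA ha hb
  obtain ⟨hle, heq⟩ := weightedBound (max m n) _ _ (admissible_seqWeight hcm hc r)
    (admissible_seqWeight hdm hd s) _ (hsub (le_max_left m n) A) _ (hsub (le_max_right m n) B)
    hcross
  rw [weight_starFam c r (le_max_left m n), weight_starFam d s (le_max_right m n)] at hle heq
  have hprod := Nat.mul_le_mul (card_le_weight hA) (card_le_weight hB)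
  refine ⟨hprod.trans hle, fun h => ?_⟩
  have hw := le_antisymm hle (h ▸ hprod)
  obtain ⟨p, hpA, hpB⟩ := heq hw (hw ▸ hpos)
  have hone : ∀ {l l' : ℕ} {A : Finset (Fin l → ℕ)} {B : Finset (Fin l' → ℕ)},
      CrossInt (A.image ones) (B.image ones) → {p} ∈ A.image ones → ∀ b ∈ B, ext b p = 1 := by
    intro l l' A B hc hp b hb
    obtain ⟨x, hx⟩ := hc _ hp _ (Finset.mem_image_of_mem _ hb)
    rw [Finset.mem_inter, Finset.mem_singleton, mem_ones] at hx
    exact hx.1 ▸ hx.2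
  have hA1 := hone hcross.symm hpB
  have hB1 := hone hcross hpA
  obtain ⟨a, ha, -⟩ := Finset.mem_image.1 hpA
  obtain ⟨b, hb, -⟩ := Finset.mem_image.1 hpB
  have hpm : p < m := lt_of_ext_ne_zero (a := a) (by rw [hA1 a ha]; exact one_ne_zero)
  have hpn : p < n := lt_of_ext_ne_zero (a := b) (by rw [hB1 b hb]; exact one_ne_zero)
  exact ⟨⟨p, hpm⟩, ⟨p, hpn⟩, 1, rfl, le_rfl,
    fun a ha => mem_seqStar.2 ⟨hA ha, (ext_val a ⟨p, hpm⟩).symm.trans (hA1 a ha)⟩,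
    fun b hb => mem_seqStar.2 ⟨hB hb, (ext_val b ⟨p, hpn⟩).symm.trans (hB1 b hb)⟩⟩

/-- The bound and the location of the extremal sets, by induction along compressions. -/
lemma card_bound [NeZero m] [NeZero n] {c : Fin m → ℕ} {d : Fin n → ℕ} {r s : ℕ}
    (hcI : IsIPSeq c) (hdI : IsIPSeq d) (hc : ∀ i, 3 ≤ c i) (hd : ∀ i, 3 ≤ d i)
    (hr : 1 ≤ r) (hrm : r ≤ m) (hs : 1 ≤ s) (hsn : s ≤ n)
    (hpos : 0 < (seqStar c r 0 1).card * (seqStar d s 0 1).card)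
    (A : Finset (Fin m → ℕ)) (B : Finset (Fin n → ℕ)) (hA : A ⊆ partialSeqs c r)
    (hB : B ⊆ partialSeqs d s) (hAB : ∀ a ∈ A, ∀ b ∈ B, Meets a b) :
    A.card * B.card ≤ (seqStar c r 0 1).card * (seqStar d s 0 1).card ∧
      (A.card * B.card = (seqStar c r 0 1).card * (seqStar d s 0 1).card →
        InStars c d r s A B) := by
  induction hN : (∑ a ∈ A, ∑ j, a j) + ∑ b ∈ B, ∑ j, b j using Nat.strong_induction_on
    generalizing A B with
  | _ N IH =>
  by_cases hall : ∀ i k, 2 ≤ k →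
      compression (setOne i k) A = A ∧ compression (setOne i k) B = B
  · exact card_bound_of_stable hcI.2 hdI.2 hc hd hpos hA hB hAB
      (fun i k hk a ha => mem_of_compression_eq (hall i k hk).1 ha)
  · push Not at hall
    obtain ⟨i, k, hk, hne⟩ := hall
    have hle : ∀ {l : ℕ} (a : Fin l → ℕ), ∑ j, setOne i k a j ≤ ∑ j, a j := fun a => by
      by_cases h : setOne i k a = a
      · rw [h]
      · exact (sum_setOne_lt hk a h).le
    have hdec : (∑ a ∈ compression (setOne i k) A, ∑ j, a j) +
        ∑ b ∈ compression (setOne i k) B, ∑ j, b j < N := by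
      rw [← hN]
      by_cases h : compression (setOne i k) A = A
      · exact add_lt_add_of_le_of_lt (sum_compression_le setOne_injective_of_ne hle A)
          (sum_compression_lt setOne_injective_of_ne (sum_setOne_lt hk) (hne h))
      · exact add_lt_add_of_lt_of_le (sum_compression_lt setOne_injective_of_ne
          (sum_setOne_lt hk) h) (sum_compression_le setOne_injective_of_ne hle B)
    obtain ⟨h1, h2⟩ := IH _ hdec (compression (setOne i k) A) (compression (setOne i k) B)
      (compression_subset_partialSeqs hcI.1 hk hA) (compression_subset_partialSeqs hdI.1 hk hB)
      (meets_compression hk hAB) rfl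
    rw [card_compression setOne_injective_of_ne, card_compression setOne_injective_of_ne] at h1 h2
    refine ⟨h1, fun heq => ?_⟩
    obtain ⟨p, p', q, hp, hq, hpA, hpB⟩ := h2 heq
    obtain ⟨⟨hA', hB'⟩, -⟩ := eq_seqStar_of_card hcI hdI hq hpA hpB hpos (by
      rwa [card_compression setOne_injective_of_ne, card_compression setOne_injective_of_ne])
    exact inStars_of_compression hc hd hr hrm hs hsn hA hB hAB
      (Finset.card_pos.1 (Nat.pos_of_mul_pos_right (heq ▸ hpos))) hk hp hq hA' hB'

end Main

end CrossIntersecting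

theorem theorem2 {m n : ℕ} [NeZero m] [NeZero n] (c : Fin m → ℕ) (d : Fin n → ℕ)
    (hc : IsIPSeq c) (hd : IsIPSeq d) (hc3 : 3 ≤ c 0) (hd3 : 3 ≤ d 0)
    (r s : ℕ) (hr : 1 ≤ r) (hrm : r ≤ m) (hs : 1 ≤ s) (hsn : s ≤ n)
    (A : Finset (Fin m → ℕ)) (B : Finset (Fin n → ℕ))
    (hA : A ⊆ partialSeqs c r) (hB : B ⊆ partialSeqs d s)
    (hAB : ∀ a ∈ A, ∀ b ∈ B, Meets a b) :
    (seqStar c r 0 1).card = starSum c r ∧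
    (seqStar d s 0 1).card = starSum d s ∧
    A.card * B.card ≤ (seqStar c r 0 1).card * (seqStar d s 0 1).card ∧
    (A.card * B.card = (seqStar c r 0 1).card * (seqStar d s 0 1).card ↔
      ∃ (p : Fin m) (p' : Fin n) (q : ℕ), (p : ℕ) = (p' : ℕ) ∧
        (r = 1 ∨ c p = c 0) ∧ (s = 1 ∨ d p' = d 0) ∧
        1 ≤ q ∧ q ≤ c p ∧ q ≤ d p' ∧
        A = seqStar c r p q ∧ B = seqStar d s p' q) := by
  have hc' : ∀ i, 3 ≤ c i := fun i => hc3.trans (hc.2 (Fin.zero_le i))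
  have hd' : ∀ i, 3 ≤ d i := fun i => hd3.trans (hd.2 (Fin.zero_le i))
  have hpos : 0 < (seqStar c r 0 1).card * (seqStar d s 0 1).card :=
    Nat.mul_pos (CrossIntersecting.seqStar_nonempty hc' hr hrm 0).card_pos
      (CrossIntersecting.seqStar_nonempty hd' hs hsn 0).card_pos
  obtain ⟨hle, heq⟩ :=
    CrossIntersecting.card_bound hc hd hc' hd' hr hrm hs hsn hpos A B hA hB hAB
  refine ⟨CrossIntersecting.card_seqStar_eq_starSum hc hr,
    CrossIntersecting.card_seqStar_eq_starSum hd hs, hle, fun h => ?_, ?_⟩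
  · obtain ⟨p, p', q, hp, hq, hpA, hpB⟩ := heq h
    obtain ⟨⟨hA', hB'⟩, h1, h2⟩ := CrossIntersecting.eq_seqStar_of_card hc hd hq hpA hpB hpos h
    obtain ⟨a, ha⟩ := Finset.card_pos.1 (Nat.pos_of_mul_pos_right (h ▸ hpos))
    obtain ⟨b, hb⟩ := Finset.card_pos.1 (Nat.pos_of_mul_pos_left (h ▸ hpos))
    have hqc : q ≤ c p :=
      (CrossIntersecting.mem_seqStar.1 (hpA ha)).2 ▸
        (CrossIntersecting.mem_partialSeqs.1 (hA ha)).1 p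
    have hqd : q ≤ d p' :=
      (CrossIntersecting.mem_seqStar.1 (hpB hb)).2 ▸
        (CrossIntersecting.mem_partialSeqs.1 (hB hb)).1 p'
    exact ⟨p, p', q, hp, (CrossIntersecting.card_seqStar_eq_iff hc hr hrm hq hqc).1 h1,
      (CrossIntersecting.card_seqStar_eq_iff hd hs hsn hq hqd).1 h2, hq, hqc, hqd, hA', hB'⟩
  · rintro ⟨p, p', q, -, hcp, hdp, hq, hqc, hqd, rfl, rfl⟩
    rw [(CrossIntersecting.card_seqStar_eq_iff hc hr hrm hq hqc).2 hcp,
      (CrossIntersecting.card_seqStar_eq_iff hd hs hsn hq hqd).2 hdp]
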